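/- Let $k\ge 1$ and let $\varphi$ be a Boolean function on the variables $V=\{0,\dots,k\}$, i.e. a map $\varphi:2^V\to\{0,1\}$ (not necessarily monotone). Its Euler characteristic is $e(\varphi)=\sum_{\nu\subseteq V,\ \varphi(\nu)=1}(-1)^{|\nu|}$. Let $R,S_1,\dots,S_k,T$ be pairwise distinct relation symbols, $R$ and $T$ unary and $S_1,\dots,S_k$ binary, and let $$h_{k,0}=\exists x\,\exists y\; R(x)\wedge S_1(x,y),\qquad h_{k,i}=\exists x\,\exists y\; S_i(x,y)\wedge S_{i+1}(x,y)\ \ (1\le i<k),\qquad h_{k,k}=\exists x\,\exists y\; S_k(x,y)\wedge T(y).$$ The query $Q_\varphi$ is $\varphi[0\mapsto h_{k,0},\dots,k\mapsto h_{k,k}]$: a database $D$ (a finite set of facts over $R,S_1,\dots,S_k,T$) satisfies $Q_\varphi$ if and only if $\varphi(\{i\in V: D\models h_{k,i}\})=1$. The lineage of $Q_\varphi$ on $D$ is the Boolean function whose variables are the facts of $D$ and that maps each $D'\subseteq D$ to true if and only if $D'\models Q_\varphi$. A d-D (deterministic decomposable circuit) is a Boolean circuit with variable, $\neg$-, $\wedge$-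 and $\vee$-gates, the latter two of arbitrary finite fan-in (an empty conjunction is true, an empty disjunction is false), such that any two distinct inputs of an $\wedge$-gate depend on disjoint sets of variables (no variable has a directed path to both) and any two distinct inputs of an $\vee$-gate capture disjoint Boolean functions (no valuation satisfies both). **Theorem.** If $e(\varphi)=0$, then there is an algorithm (depending on $k$ and $\varphi$ only) that, given an arbitrary database $D$, computes, in time polynomial in $|D|$, a d-D that represents the lineage of $Q_\varphi$ on $D$. Here the algorithm is a program of a random access machine whose instructions (constants, addition, truncated subtraction, indirect load and store, output, tests, while-loops) cost one step each, the constants occurring in $D$ are natural numbers occupying one machine word each, and $|D|$ is the number of facts of $D$. -/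

import Mathlib

namespace HQueries

/-! ### Boolean functions and their Euler characteristic -/

/-- A Boolean function on the variables `{0, …, k}`; a valuation is a subset of the variables. -/
abbrev BoolFun (k : ℕ) : Type := Finset (Fin (k + 1)) → Bool

/-- The Euler characteristic: the sum of `(-1) ^ |ν|` over the satisfying valuations `ν`. -/
def eulerChar {k : ℕ} (φ : BoolFun k) : ℤ :=
  ∑ ν ∈ Finset.univ.filter (fun ν : Finset (Fin (k + 1)) => φ ν = true), (-1 : ℤ) ^ ν.card

/-! ### Databases, Boolean queries, and the H-queries -/

/-- Facts (tuples) over the schema `R, S₁, …, S_k, T`, with `R`, `T` unary and `S₁, …, S_k` binary.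
Constants are natural numbers.  A database is a finite set of facts. -/
inductive DBFact (k : ℕ) : Type
  | R (a : ℕ) : DBFact k
  | S (i : {i : ℕ // 1 ≤ i ∧ i ≤ k}) (a b : ℕ) : DBFact k
  | T (b : ℕ) : DBFact k

/-- A Boolean query: it tells which (sub-)databases satisfy it. -/
abbrev Query (k : ℕ) : Type := Set (DBFact k) → Prop

/-- `S_i(a, b)` is a fact of `D`. -/
def holdsS {k : ℕ} (D : Set (DBFact k)) (i a b : ℕ) : Prop :=
  ∃ h : 1 ≤ i ∧ i ≤ k, DBFact.S ⟨i, h⟩ a b ∈ D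

/-- The conjunctive query `h_{k,i}` for `0 ≤ i ≤ k` (where `k ≥ 1`):
`h_{k,0} = ∃ x y, R(x) ∧ S₁(x,y)`,
`h_{k,i} = ∃ x y, S_i(x,y) ∧ S_{i+1}(x,y)` for `1 ≤ i < k`, and
`h_{k,k} = ∃ x y, S_k(x,y) ∧ T(y)`. -/
def hQuery (k : ℕ) (i : Fin (k + 1)) : Query k := fun D =>
  if (i : ℕ) = 0 then ∃ x y, DBFact.R x ∈ D ∧ holdsS D 1 x y
  else if (i : ℕ) < k then ∃ x y, holdsS D i x y ∧ holdsS D (i + 1) x y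
  else ∃ x y, holdsS D k x y ∧ DBFact.T y ∈ D

open Classical in
/-- The H-query `Q_φ`: the Boolean combination `φ[0 ↦ h_{k,0}, …, k ↦ h_{k,k}]`. -/
noncomputable def queryOf {k : ℕ} (φ : BoolFun k) : Query k := fun D =>
  φ (Finset.univ.filter fun i => hQuery k i D) = true

/-! ### Boolean circuits and d-Ds -/

/-- A gate of a Boolean circuit with variables in `X`; gates are referred to by their position. -/
inductive Gate (X : Type) : Type
  | var (x : X) : Gate X
  | neg (j : ℕ) : Gate X
  | and (J : List ℕ) : Gate X
  | or (J : List ℕ) : Gate X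

/-- The input gates of a gate. -/
def Gate.inputs {X : Type} : Gate X → List ℕ
  | .var _ => []
  | .neg j => [j]
  | .and J => J
  | .or J => J

/-- The value of a gate under the valuation `ν`, given the list `v` of values of the earlier gates.
An `∧`-gate without inputs is the constant true, an `∨`-gate without inputs the constant false. -/
def Gate.eval {X : Type} (ν : Set X) (v : List Prop) : Gate X → Prop
  | .var x => x ∈ ν
  | .neg j => ¬ v.getD j False
  | .and J => ∀ j ∈ J, v.getD j False
  | .or J => ∃ j ∈ J, v.getD j False

/-- A Boolean circuit: a nonempty list of gates in topological order (the inputs of each gate are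
pairwise distinct earlier gates), of arbitrary fan-in.  The last gate is the output gate. -/
structure Circuit (X : Type) : Type where
  gates : List (Gate X)
  nonempty : gates ≠ []
  inputs_lt : ∀ (i : ℕ) (g : Gate X), gates[i]? = some g → ∀ j ∈ g.inputs, j < i
  inputs_nodup : ∀ g ∈ gates, g.inputs.Nodup

namespace Circuit

variable {X : Type}

/-- The values of all gates under the valuation `ν`, computed bottom-up. -/
def values (C : Circuit X) (ν : Set X) : List Prop :=
  C.gates.foldl (fun v g => v ++ [g.eval ν v]) []

/-- The Boolean function captured by the gate number `i`. -/
def val (C : Circuit X) (i : ℕ) (ν : Set X) : Prop := (C.values ν).getD i False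

/-- The Boolean function captured by the circuit, i.e. by its output gate. -/
def eval (C : Circuit X) (ν : Set X) : Prop := C.val (C.gates.length - 1) ν

/-- `C.HasVar i x`: a variable gate labelled `x` has a directed path to the gate number `i`. -/
inductive HasVar (C : Circuit X) : ℕ → X → Prop
  | var {i : ℕ} {x : X} (h : C.gates[i]? = some (Gate.var x)) : HasVar C i x
  | step {i j : ℕ} {g : Gate X} {x : X} (h : C.gates[i]? = some g) (hj : j ∈ g.inputs)
      (hx : HasVar C j x) : HasVar C i x

/-- Every `∧`-gate is decomposable: distinct inputs depend on disjoint sets of variables. -/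
def Decomposable (C : Circuit X) : Prop :=
  ∀ (i : ℕ) (J : List ℕ), C.gates[i]? = some (Gate.and J) → ∀ j₁ ∈ J, ∀ j₂ ∈ J, j₁ ≠ j₂ →
    ∀ x, ¬ (C.HasVar j₁ x ∧ C.HasVar j₂ x)

/-- Every `∨`-gate is deterministic: distinct inputs capture disjoint Boolean functions. -/
def Deterministic (C : Circuit X) : Prop :=
  ∀ (i : ℕ) (J : List ℕ), C.gates[i]? = some (Gate.or J) → ∀ j₁ ∈ J, ∀ j₂ ∈ J, j₁ ≠ j₂ →
    ∀ ν, ¬ (C.val j₁ ν ∧ C.val j₂ ν)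

/-- A deterministic decomposable circuit (d-D). -/
def IsDD (C : Circuit X) : Prop := C.Deterministic ∧ C.Decomposable

end Circuit

/-- `C` represents the lineage of `Q` on `D`: its variables are facts of `D`, and it maps each
sub-database `D' ⊆ D` to true or false depending on whether `D'` satisfies `Q`. -/
def RepresentsLineage {k : ℕ} (C : Circuit (DBFact k)) (Q : Query k) (D : Finset (DBFact k)) : Prop :=
  (∀ x, Gate.var x ∈ C.gates → x ∈ D) ∧
    ∀ D' : Set (DBFact k), D' ⊆ (D : Set (DBFact k)) → (C.eval D' ↔ Q D')

/-! ### Random access machines with a step count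

Programs of a deterministic random access machine with registers `X₀, X₁, …` and memory cells
`M[0], M[1], …`, all holding natural numbers, and a write-only output tape.  The only arithmetic is
addition and truncated subtraction (no multiplication), so that counting one step for each
instruction is polynomially equivalent to counting the steps of a Turing machine. -/

inductive Prog : Type
  | const (r c : ℕ) : Prog -- `X_r := c`
  | add (r s t : ℕ) : Prog -- `X_r := X_s + X_t`
  | sub (r s t : ℕ) : Prog -- `X_r := X_s - X_t` (truncated)
  | load (r s : ℕ) : Prog -- `X_r := M[X_s]`
  | store (r s : ℕ) : Prog -- `M[X_r] := X_s`
  | emit (r : ℕ) : Prog -- write `X_r` on the output tape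
  | seq (p q : Prog) : Prog -- `p; q`
  | ite (r : ℕ) (p q : Prog) : Prog -- `if X_r ≠ 0 then p else q`
  | loop (r : ℕ) (p : Prog) : Prog -- `while X_r ≠ 0 do p`

/-- A configuration: registers, memory, and the output written so far. -/
structure State : Type where
  reg : ℕ → ℕ
  mem : ℕ → ℕ
  out : List ℕ

/-- The configuration `σ` with the value of the register `X_r` replaced by `n`. -/
def State.setReg (σ : State) (r n : ℕ) : State := { σ with reg := Function.update σ.reg r n }

/-- `Exec p σ t τ`: started in `σ`, the program `p` halts in `τ` after exactly `t` steps.  Every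
elementary instruction and every test takes one step. -/
inductive Exec : Prog → State → ℕ → State → Prop
  | const (σ : State) (r c : ℕ) : Exec (.const r c) σ 1 (σ.setReg r c)
  | add (σ : State) (r s t : ℕ) : Exec (.add r s t) σ 1 (σ.setReg r (σ.reg s + σ.reg t))
  | sub (σ : State) (r s t : ℕ) : Exec (.sub r s t) σ 1 (σ.setReg r (σ.reg s - σ.reg t))
  | load (σ : State) (r s : ℕ) : Exec (.load r s) σ 1 (σ.setReg r (σ.mem (σ.reg s)))
  | store (σ : State) (r s : ℕ) :
      Exec (.store r s) σ 1 { σ with mem := Function.update σ.mem (σ.reg r) (σ.reg s) }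
  | emit (σ : State) (r : ℕ) : Exec (.emit r) σ 1 { σ with out := σ.out ++ [σ.reg r] }
  | seq {p q : Prog} {σ τ υ : State} {m n : ℕ} (hp : Exec p σ m τ) (hq : Exec q τ n υ) :
      Exec (.seq p q) σ (m + n) υ
  | ite_true {r : ℕ} {p q : Prog} {σ τ : State} {m : ℕ} (h : σ.reg r ≠ 0) (hp : Exec p σ m τ) :
      Exec (.ite r p q) σ (m + 1) τ
  | ite_false {r : ℕ} {p q : Prog} {σ τ : State} {m : ℕ} (h : σ.reg r = 0) (hq : Exec q σ m τ) :
      Exec (.ite r p q) σ (m + 1) τ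
  | loop_done {r : ℕ} {p : Prog} {σ : State} (h : σ.reg r = 0) : Exec (.loop r p) σ 1 σ
  | loop_step {r : ℕ} {p : Prog} {σ τ υ : State} {m n : ℕ} (h : σ.reg r ≠ 0)
      (hp : Exec p σ m τ) (hl : Exec (.loop r p) τ n υ) : Exec (.loop r p) σ (m + n + 1) υ

/-- The machine is deterministic: the final configuration and the step count are determined. -/
theorem Exec.deterministic {p : Prog} {σ τ τ' : State} {t t' : ℕ}
    (h : Exec p σ t τ) (h' : Exec p σ t' τ') : t = t' ∧ τ = τ' := by
  induction h generalizing t' τ' with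
  | const | add | sub | load | store | emit => cases h'; exact ⟨rfl, rfl⟩
  | seq _ _ ihp ihq =>
    cases h' with
    | seq hp hq =>
      obtain ⟨rfl, rfl⟩ := ihp hp
      obtain ⟨rfl, rfl⟩ := ihq hq
      exact ⟨rfl, rfl⟩
  | ite_true h _ ih =>
    cases h' with
    | ite_true _ hp => obtain ⟨rfl, rfl⟩ := ih hp; exact ⟨rfl, rfl⟩
    | ite_false h0 _ => exact absurd h0 h
  | ite_false h _ ih =>
    cases h' with
    | ite_true h0 _ => exact absurd h h0
    | ite_false _ hp => obtain ⟨rfl, rfl⟩ := ih hp; exact ⟨rfl, rfl⟩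
  | loop_done h =>
    cases h' with
    | loop_done _ => exact ⟨rfl, rfl⟩
    | loop_step h0 _ _ => exact absurd h h0
  | loop_step h _ _ ihp ihl =>
    cases h' with
    | loop_done h0 => exact absurd h0 h
    | loop_step _ hp hl =>
      obtain ⟨rfl, rfl⟩ := ihp hp
      obtain ⟨rfl, rfl⟩ := ihl hl
      exact ⟨rfl, rfl⟩

/-! ### Encodings and the class d-D(PTIME) -/

/-- A fact as three machine words: relation number and arguments (padded with `0`). -/
def DBFact.code {k : ℕ} : DBFact k → List ℕ
  | .R a => [0, a, 0]
  | .S i a b => [i, a, b]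
  | .T b => [k + 1, b, 0]

/-- The input configuration for the facts listed in `L`: `M[0]` is the number of facts, and then
the facts follow, three words each; everything else is zero and the output is empty. -/
def inputState {k : ℕ} (L : List (DBFact k)) : State where
  reg := fun _ => 0
  mem := fun a => (L.length :: L.flatMap DBFact.code).getD a 0
  out := []

/-- A gate as a sequence of machine words (a prefix code). -/
def Gate.code {k : ℕ} : Gate (DBFact k) → List ℕ
  | .var x => 0 :: x.code
  | .neg j => [1, j]
  | .and J => 2 :: J.length :: J
  | .or J => 3 :: J.length :: J

/-- A circuit as a sequence of machine words: its gates one after the other. -/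
def Circuit.code {k : ℕ} (C : Circuit (DBFact k)) : List ℕ := C.gates.flatMap Gate.code

/-- The class d-D(PTIME): some program, on every database `D` (given by listing its facts in any
order without repetition), halts after a number of steps that is polynomial in `|D|` and outputs
a d-D that represents the lineage of `Q` on `D`.  The query is fixed (data complexity). -/
def InDDPTIME {k : ℕ} (Q : Query k) : Prop :=
  ∃ (P : Prog) (p : Polynomial ℕ), ∀ (D : Finset (DBFact k)) (L : List (DBFact k)),
    L.Nodup → (∀ x, x ∈ L ↔ x ∈ D) →
      ∃ (t : ℕ) (τ : State) (C : Circuit (DBFact k)),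
        Exec P (inputState L) t τ ∧ t ≤ p.eval D.card ∧
          τ.out = C.code ∧ C.IsDD ∧ RepresentsLineage C Q D

end HQueries

namespace HQueries

/-! ### Boolean functions of Euler characteristic zero -/

/-! Euler characteristic zero means that `φ` has as many satisfying valuations of even size as of
odd size. If `c` is a neighbour of both `a` and `b`, then `a` can be traded for `b` by adding one of
the pairs `{a, c}`, `{c, b}` and removing the other. Hence valuations of equal parity are
interchangeable, a satisfying valuation can be moved next to one of opposite parity, and the two can
be removed together. By induction the satisfying family arises from the empty one by adding disjoint
pairs `{N, insert l N}` and removing contained ones (`pairReachable_of_sum_eq_zero`). This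
derivation depends on `φ` only.

For a single pair, the condition that the set of true queries is `N` or `insert l N` leaves
`h_{k,l}` free and prescribes all the others. The queries before `l` involve relations numbered at
most `l`, those after `l` only larger ones, so the condition is a conjunction of two conditions on
disjoint sets of facts (`matchesPattern_iff`). In the lower half all joins share `x`, in the upper
half all share `y`. With the facts grouped by the shared argument and then by the other one, a
deterministic automaton with a number of states depending on `k` only decides each half while
reading every fact once (`featuresOf_insert`).

The run of such an automaton on a subset of the facts becomes a circuit with one gate for each state
and stage. The ∨-gates are deterministic because the automaton is in exactly one state, and the
∧-gates are decomposable because the fact being read has not occurred before (`certified_read`). The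
pairs are combined along the derivation: adding a pair is a disjoint ∨, and removing a pair `P` from
`F` is ¬(¬`F` ∨ `P`), whose ∨ is disjoint because `P` is contained in `F` (`exists_prog_captures`).

The machine emits the gates while it enumerates groups and cells. All its loops count down from the
number of facts and their nesting depth is fixed, which gives the polynomial bound (`Reaches.loop`).
-/

theorem exists_mem_of_sum_eq_zero {α : Type} {A : Finset (Finset α)}
    (h : ∑ ν ∈ A, (-1 : ℤ) ^ ν.card = 0) {v : Finset α} (hv : v ∈ A) :
    ∃ w ∈ A, (-1 : ℤ) ^ w.card = -(-1) ^ v.card := by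
  by_contra! hc
  -- Without a member of opposite sign all summands agree, so the sum is ± the size of `A` and
  -- cannot vanish.
  have h1 : ∀ w ∈ A, (-1 : ℤ) ^ w.card = (-1) ^ v.card := by
    intro w hw
    have := hc w hw
    rcases neg_one_pow_eq_or ℤ w.card with e | e <;>
      rcases neg_one_pow_eq_or ℤ v.card with e' | e' <;> simp_all
  rw [Finset.sum_congr rfl h1, Finset.sum_const] at h
  simp only [smul_eq_zero, Finset.card_eq_zero] at h
  rcases h with h | h
  · simp [h] at hv
  · simp at h

section PairReachable

variable {α : Type} [DecidableEq α]

/-- The families of valuations that arise from the empty one by adding and removing pairs of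
valuations that differ in exactly one variable. -/
inductive PairReachable : Finset (Finset α) → Prop
  | empty : PairReachable ∅
  | union {A : Finset (Finset α)} (h : PairReachable A) (N : Finset α) (l : α) (hl : l ∉ N)
      (h₁ : N ∉ A) (h₂ : insert l N ∉ A) : PairReachable (A ∪ {N, insert l N})
  | sdiff {A : Finset (Finset α)} (h : PairReachable A) (N : Finset α) (l : α) (hl : l ∉ N)
      (h₁ : N ∈ A) (h₂ : insert l N ∈ A) : PairReachable (A \ {N, insert l N})

/-- Two valuations differ in exactly one variable. -/
def Adjacent (u v : Finset α) : Prop := ∃ l, v = symmDiff u {l}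

theorem Adjacent.exists_insert {u v : Finset α} (h : Adjacent u v) :
    ∃ N l, l ∉ N ∧ ({u, v} : Finset (Finset α)) = {N, insert l N} := by
  obtain ⟨l, rfl⟩ := h
  by_cases hl : l ∈ u
  · refine ⟨u.erase l, l, by simp, ?_⟩
    have h1 : symmDiff u {l} = u.erase l := by
      ext x; simp only [Finset.mem_symmDiff, Finset.mem_singleton, Finset.mem_erase]; grind
    rw [h1, Finset.insert_erase hl, Finset.pair_comm]
  · refine ⟨u, l, hl, ?_⟩
    have h1 : symmDiff u {l} = insert l u := by
      ext x; simp only [Finset.mem_symmDiff, Finset.mem_singleton, Finset.mem_insert]; grind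
    rw [h1]

/-- The two rules undo each other, so a pair may be added or removed in either direction of the
equivalence. This makes reachability an invariant that can be transported by rewriting. -/
theorem pairReachable_union_iff {A : Finset (Finset α)} {u v : Finset α} (h : Adjacent u v)
    (hu : u ∉ A) (hv : v ∉ A) : PairReachable (A ∪ {u, v}) ↔ PairReachable A := by
  obtain ⟨N, l, hl, e⟩ := h.exists_insert
  have hN : ∀ x ∈ ({N, insert l N} : Finset (Finset α)), x ∉ A := by
    rw [← e]; simp [hu, hv]
  rw [e]
  constructor
  · intro h'
    have := h'.sdiff N l hl (by simp) (by simp)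
    rwa [Finset.union_sdiff_cancel_right] at this
    exact Finset.disjoint_right.2 hN
  · intro h'
    exact h'.union N l hl (hN _ (by simp)) (hN _ (by simp))

theorem pairReachable_sdiff_iff {A : Finset (Finset α)} {u v : Finset α} (h : Adjacent u v)
    (hu : u ∈ A) (hv : v ∈ A) : PairReachable (A \ {u, v}) ↔ PairReachable A := by
  rw [← pairReachable_union_iff (A := A \ {u, v}) h (by simp) (by simp),
    Finset.sdiff_union_of_subset]
  intro x; simp only [Finset.mem_insert, Finset.mem_singleton]; rintro (rfl | rfl) <;> assumption

theorem Adjacent.symm {u v : Finset α} (h : Adjacent u v) : Adjacent v u := by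
  obtain ⟨l, rfl⟩ := h
  exact ⟨l, by rw [symmDiff_symmDiff_cancel_right]⟩

theorem Adjacent.ne {u v : Finset α} (h : Adjacent u v) : u ≠ v := by
  obtain ⟨l, rfl⟩ := h
  intro e
  have := congrArg (l ∈ ·) e
  simp only [Finset.mem_symmDiff, Finset.mem_singleton] at this
  grind

/-- Exchanging the valuations `a` and `b` does not affect reachability. -/
def Exchangeable (a b : Finset α) : Prop :=
  ∀ A : Finset (Finset α), PairReachable A ↔ PairReachable (A.map (Equiv.swap a b).toEmbedding)

theorem Exchangeable.refl (a : Finset α) : Exchangeable a a := by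
  intro A; simp

theorem mem_map_swap {β : Type*} [DecidableEq β] (A : Finset β) (a b x : β) :
    x ∈ A.map (Equiv.swap a b).toEmbedding ↔ Equiv.swap a b x ∈ A := by
  rw [Finset.mem_map_equiv, Equiv.symm_swap]

/-- For distinct valuations the transposition (a b) is the conjugate (a c)(c b)(a c); coincidences
are treated separately. -/
theorem Exchangeable.trans {a b c : Finset α} (h₁ : Exchangeable a c) (h₂ : Exchangeable c b) :
    Exchangeable a b := by
  by_cases hab : a = b
  · subst hab; exact .refl a
  by_cases hac : a = c
  · subst hac; exact h₂
  by_cases hcb : c = b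
  · subst hcb; exact h₁
  intro A
  rw [h₁ A, h₂, h₁]
  have : ((A.map (Equiv.swap a c).toEmbedding).map (Equiv.swap c b).toEmbedding).map
      (Equiv.swap a c).toEmbedding = A.map (Equiv.swap a b).toEmbedding := by
    ext x
    simp only [mem_map_swap]
    have : Equiv.swap a c (Equiv.swap c b (Equiv.swap a c x)) = Equiv.swap a b x := by
      simp only [Equiv.swap_apply_def]; grind
    rw [this]
  rw [this]

/-- If the common neighbour `c` is in `A`, remove `{a, c}` and then add `{c, b}`; otherwise add `{c,
b}` and then remove `{a, c}`. Either way `c` is restored and `a` has turned into `b`. -/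
theorem exchangeable_aux {a b c : Finset α} (hac : Adjacent a c) (hcb : Adjacent c b)
    {A : Finset (Finset α)} (ha : a ∈ A) (hb : b ∉ A) :
    PairReachable A ↔ PairReachable (A.map (Equiv.swap a b).toEmbedding) := by
  have h1 := hac.ne
  have h2 := hcb.ne
  have hab : a ≠ b := by rintro rfl; exact hb ha
  by_cases hc : c ∈ A
  · rw [← pairReachable_sdiff_iff hac ha hc,
      ← pairReachable_union_iff (A := A \ {a, c}) hcb (by simp) (by simp [hb])]
    have : A \ {a, c} ∪ {c, b} = A.map (Equiv.swap a b).toEmbedding := by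
      ext x
      simp only [mem_map_swap, Equiv.swap_apply_def, Finset.mem_union, Finset.mem_sdiff,
        Finset.mem_insert, Finset.mem_singleton]
      grind
    rw [this]
  · rw [← pairReachable_union_iff hcb hc hb,
      ← pairReachable_sdiff_iff (A := A ∪ {c, b}) hac (by simp [ha]) (by simp)]
    have : (A ∪ {c, b}) \ {a, c} = A.map (Equiv.swap a b).toEmbedding := by
      ext x
      simp only [mem_map_swap, Equiv.swap_apply_def, Finset.mem_union, Finset.mem_sdiff,
        Finset.mem_insert, Finset.mem_singleton]
      grind
    rw [this]

theorem Adjacent.exchangeable {a b c : Finset α} (hac : Adjacent a c) (hcb : Adjacent c b) :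
    Exchangeable a b := by
  intro A
  by_cases ha : a ∈ A <;> by_cases hb : b ∈ A
  · have : A.map (Equiv.swap a b).toEmbedding = A := by
      ext x; simp only [mem_map_swap, Equiv.swap_apply_def]; grind
    rw [this]
  · exact exchangeable_aux hac hcb ha hb
  · rw [Equiv.swap_comm]; exact exchangeable_aux hcb.symm hac.symm hb ha
  · have : A.map (Equiv.swap a b).toEmbedding = A := by
      ext x; simp only [mem_map_swap, Equiv.swap_apply_def]; grind
    rw [this]

theorem neg_one_pow_card_symmDiff_singleton (u : Finset α) (l : α) :
    (-1 : ℤ) ^ (symmDiff u {l}).card = -(-1) ^ u.card := by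
  by_cases hl : l ∈ u
  · have h1 : symmDiff u {l} = u.erase l := by
      ext x; simp only [Finset.mem_symmDiff, Finset.mem_singleton, Finset.mem_erase]; grind
    rw [h1, ← Finset.card_erase_add_one hl, pow_succ]; simp
  · have h1 : symmDiff u {l} = insert l u := by
      ext x; simp only [Finset.mem_symmDiff, Finset.mem_singleton, Finset.mem_insert]; grind
    rw [h1, Finset.card_insert_of_notMem hl, pow_succ]; simp

theorem card_symmDiff_symmDiff_singleton_lt {a b : Finset α} {i : α} (hi : i ∈ symmDiff a b) :
    (symmDiff (symmDiff a {i}) b).card < (symmDiff a b).card := by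
  have : symmDiff (symmDiff a {i}) b = (symmDiff a b).erase i := by
    ext x; simp only [Finset.mem_symmDiff, Finset.mem_singleton, Finset.mem_erase] at *; grind
  rw [this]; exact Finset.card_erase_lt_of_mem hi

/-- Induction on the Hamming distance, flipping two differing variables at a time. Both intermediate
flips are adjacencies, so `Adjacent.exchangeable` applies to each double step. -/
theorem exchangeable_of_parity (n : ℕ) (a b : Finset α) (hn : (symmDiff a b).card ≤ n)
    (h : (-1 : ℤ) ^ a.card = (-1) ^ b.card) : Exchangeable a b := by
  induction n using Nat.strong_induction_on generalizing a with
  | _ n ih =>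
    by_cases hab : a = b
    · subst hab; exact .refl a
    have ne : ∀ {x : Finset α}, x ≠ b → (symmDiff x b).Nonempty := fun hx => by
      rw [Finset.nonempty_iff_ne_empty]; intro e; exact hx (symmDiff_eq_bot.1 e)
    obtain ⟨i, hi⟩ := ne hab
    have hs := neg_one_pow_card_symmDiff_singleton a i
    -- A single flip reverses the sign, so the target is not reached yet and a second differing
    -- variable exists.
    have hne : symmDiff a {i} ≠ b := by
      intro e
      rw [e, h] at hs
      have : (-1 : ℤ) ^ b.card ≠ 0 := by simp
      omega
    obtain ⟨j, hj⟩ := ne hne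
    have l1 := card_symmDiff_symmDiff_singleton_lt hi
    have l2 := card_symmDiff_symmDiff_singleton_lt hj
    refine Exchangeable.trans (c := symmDiff (symmDiff a {i}) {j})
      (Adjacent.exchangeable ⟨i, rfl⟩ ⟨j, rfl⟩) (ih _ (lt_of_lt_of_le (l2.trans l1) hn) _ le_rfl ?_)
    rw [neg_one_pow_card_symmDiff_singleton, hs, neg_neg, h]

theorem sum_map_swap {A : Finset (Finset α)} {a b : Finset α}
    (h : (-1 : ℤ) ^ a.card = (-1) ^ b.card) :
    ∑ ν ∈ A.map (Equiv.swap a b).toEmbedding, (-1 : ℤ) ^ ν.card = ∑ ν ∈ A, (-1 : ℤ) ^ ν.card := by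
  rw [Finset.sum_map]
  refine Finset.sum_congr rfl fun x _ => ?_
  simp only [Equiv.toEmbedding_apply, Equiv.swap_apply_def]
  split_ifs with h1 h2
  · rw [h1, h]
  · rw [h2, h]
  · rfl

/-- Take `v` in `A`, a member `w` of opposite sign, and the neighbour `u` of `v` in a fixed
direction. Since `w` and `u` have equal parity, `w` can be moved to `u`; then `{v, u}` is a pair
inside the family, and removing it leaves a smaller family whose sum is still zero. -/
theorem pairReachable_of_sum_eq_zero [Nonempty α] (A : Finset (Finset α))
    (h : ∑ ν ∈ A, (-1 : ℤ) ^ ν.card = 0) : PairReachable A := by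
  induction hn : A.card using Nat.strong_induction_on generalizing A with
  | _ n ih =>
    rcases A.eq_empty_or_nonempty with rfl | ⟨v, hv⟩
    · exact .empty
    obtain ⟨w, hw, hwv⟩ := exists_mem_of_sum_eq_zero h hv
    obtain ⟨l⟩ := ‹Nonempty α›
    set u := symmDiff v {l} with hu
    have hadj : Adjacent v u := ⟨l, hu⟩
    have hwu : (-1 : ℤ) ^ w.card = (-1) ^ u.card := by
      rw [hwv, hu, neg_one_pow_card_symmDiff_singleton]
    have hvw : v ≠ w := by
      rintro rfl
      have : (-1 : ℤ) ^ v.card ≠ 0 := by simp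
      omega
    rw [exchangeable_of_parity _ w u le_rfl hwu A]
    have hv' : v ∈ A.map (Equiv.swap w u).toEmbedding := by
      rw [mem_map_swap, Equiv.swap_apply_of_ne_of_ne hvw hadj.ne]; exact hv
    have hu' : u ∈ A.map (Equiv.swap w u).toEmbedding := by
      rw [mem_map_swap, Equiv.swap_apply_right]; exact hw
    rw [← pairReachable_sdiff_iff hadj hv' hu']
    have hsub : ({v, u} : Finset (Finset α)) ⊆ A.map (Equiv.swap w u).toEmbedding := by
      intro x; simp only [Finset.mem_insert, Finset.mem_singleton]; rintro (rfl | rfl) <;> assumption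
    refine ih _ ?_ _ ?_ rfl
    · have hc : (A.map (Equiv.swap w u).toEmbedding).card = n := by rw [Finset.card_map, hn]
      rw [← hc]
      refine Finset.card_lt_card ⟨Finset.sdiff_subset, fun hc => ?_⟩
      simpa using hc hv'
    -- The two removed valuations contribute opposite signs, and the exchange preserved the sum.
    · have := Finset.sum_sdiff hsub (f := fun ν => (-1 : ℤ) ^ ν.card)
      rw [sum_map_swap hwu, h, Finset.sum_pair hadj.ne, hu,
        neg_one_pow_card_symmDiff_singleton] at this
      rw [hu]; linarith

end PairReachable

/-! ### Certified circuits -/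

section Certificate

variable {X : Type}

/-- A gate together with the Boolean function it captures and a set of variables that contains all
those it depends on. -/
structure AnnotatedGate (X : Type) : Type where
  gate : Gate X
  sem : Set X → Prop
  dep : Set X

/-- The function captured by the gate number `j`. -/
def semAt (A : List (AnnotatedGate X)) (j : ℕ) (ν : Set X) : Prop := ∃ e, A[j]? = some e ∧ e.sem ν

/-- The variables assigned to the gate number `j`. -/
def depAt (A : List (AnnotatedGate X)) (j : ℕ) : Set X := {x | ∃ e, A[j]? = some e ∧ x ∈ e.dep}

/-- The annotation of a gate is justified by those of its inputs. -/
def GateSound (D : Set X) (A : List (AnnotatedGate X)) (s : Set X → Prop) (d : Set X) :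
    Gate X → Prop
  | .var x => x ∈ D ∧ x ∈ d ∧ ∀ ν, s ν ↔ x ∈ ν
  | .neg j => ∀ ν, s ν ↔ ¬ semAt A j ν
  | .and J => (∀ j₁ ∈ J, ∀ j₂ ∈ J, j₁ ≠ j₂ → ∀ x, ¬ (x ∈ depAt A j₁ ∧ x ∈ depAt A j₂)) ∧
      ∀ ν, s ν ↔ ∀ j ∈ J, semAt A j ν
  | .or J => (∀ j₁ ∈ J, ∀ j₂ ∈ J, j₁ ≠ j₂ → ∀ ν, ¬ (semAt A j₁ ν ∧ semAt A j₂ ν)) ∧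
      ∀ ν, s ν ↔ ∃ j ∈ J, semAt A j ν

/-- The annotated gate `e` may follow the list `A`. -/
structure GateOK (D : Set X) (A : List (AnnotatedGate X)) (e : AnnotatedGate X) : Prop where
  lt : ∀ j ∈ e.gate.inputs, j < A.length
  nodup : e.gate.inputs.Nodup
  dep : ∀ j ∈ e.gate.inputs, depAt A j ⊆ e.dep
  sound : GateSound D A e.sem e.dep e.gate

/-- A certified circuit with variables in `D`, as a list of annotated gates. -/
inductive Certified (D : Set X) : List (AnnotatedGate X) → Prop
  | nil : Certified D []
  | snoc {A : List (AnnotatedGate X)} {e : AnnotatedGate X} (hA : Certified D A)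
      (he : GateOK D A e) : Certified D (A ++ [e])

theorem semAt_append_left {A : List (AnnotatedGate X)} {j : ℕ} (h : j < A.length)
    (B : List (AnnotatedGate X)) : semAt (A ++ B) j = semAt A j := by
  funext ν; simp only [semAt, List.getElem?_append_left h]

theorem depAt_append_left {A : List (AnnotatedGate X)} {j : ℕ} (h : j < A.length)
    (B : List (AnnotatedGate X)) : depAt (A ++ B) j = depAt A j := by
  simp only [depAt, List.getElem?_append_left h]

/-- The conditions look only at the inputs, whose positions lie in `A` and are not shifted by
appending. -/
theorem GateOK.append {D : Set X} {A : List (AnnotatedGate X)} {e : AnnotatedGate X}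
    (h : GateOK D A e) (B : List (AnnotatedGate X)) : GateOK D (A ++ B) e where
  lt j hj := by have := h.lt j hj; simp; omega
  nodup := h.nodup
  dep j hj := by rw [depAt_append_left (h.lt j hj)]; exact h.dep j hj
  sound := by
    have hlt := h.lt
    have hs := h.sound
    have e1 : ∀ j ∈ e.gate.inputs, semAt (A ++ B) j = semAt A j := fun j hj =>
      semAt_append_left (hlt j hj) B
    have e2 : ∀ j ∈ e.gate.inputs, depAt (A ++ B) j = depAt A j := fun j hj =>
      depAt_append_left (hlt j hj) B
    cases hg : e.gate with
    | var x => rw [hg] at hs; exact hs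
    | neg j =>
      rw [hg] at hs e1
      simp only [GateSound, e1 j (by simp [Gate.inputs])] at hs ⊢
      exact hs
    | and J =>
      rw [hg] at hs e1 e2
      refine ⟨fun j₁ h₁ j₂ h₂ hne => ?_, fun ν => ?_⟩
      · rw [e2 j₁ h₁, e2 j₂ h₂]; exact hs.1 j₁ h₁ j₂ h₂ hne
      · rw [hs.2]
        exact forall₂_congr fun j hj => by rw [e1 j hj]
    | or J =>
      rw [hg] at hs e1
      refine ⟨fun j₁ h₁ j₂ h₂ hne => ?_, fun ν => ?_⟩
      · rw [e1 j₁ h₁, e1 j₂ h₂]; exact hs.1 j₁ h₁ j₂ h₂ hne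
      · rw [hs.2]
        exact exists_congr fun j => and_congr_right fun hj => by rw [e1 j hj]

/-- A whole layer can be added at once when its gates refer to `A` and not to one another, so that
each is checked against the same prefix. -/
theorem Certified.append {D : Set X} {A : List (AnnotatedGate X)} (hA : Certified D A)
    (B : List (AnnotatedGate X)) (hB : ∀ e ∈ B, GateOK D A e) : Certified D (A ++ B) := by
  induction B using List.reverseRecOn with
  | nil => simpa using hA
  | append_singleton B e ih =>
    rw [← List.append_assoc]
    exact (ih fun e' he' => hB e' (by simp [he'])).snoc ((hB e (by simp)).append B)

theorem Certified.getElem? {D : Set X} {A : List (AnnotatedGate X)} (hA : Certified D A) {i : ℕ}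
    {e : AnnotatedGate X} (h : A[i]? = some e) :
    GateOK D A e ∧ ∀ j ∈ e.gate.inputs, j < i := by
  induction hA with
  | nil => simp at h
  | @snoc A e' hA he ih =>
    rcases lt_trichotomy i A.length with hi | hi | hi
    · rw [List.getElem?_append_left hi] at h
      exact ⟨(ih h).1.append _, (ih h).2⟩
    · subst hi
      simp only [List.getElem?_concat_length, Option.some.injEq] at h
      subst h
      exact ⟨he.append _, he.lt⟩
    · rw [List.getElem?_eq_none (by simp; omega)] at h
      simp at h

/-- The circuit underlying a certified circuit. -/
def Certified.circuit {D : Set X} {A : List (AnnotatedGate X)} (hA : Certified D A) (hne : A ≠ []) :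
    Circuit X where
  gates := A.map AnnotatedGate.gate
  nonempty := by simpa using hne
  inputs_lt i g h := by
    rw [List.getElem?_map, Option.map_eq_some_iff] at h
    obtain ⟨e, he, rfl⟩ := h
    exact (hA.getElem? he).2
  inputs_nodup g hg := by
    obtain ⟨e, he, rfl⟩ := List.mem_map.1 hg
    obtain ⟨i, hi⟩ := List.mem_iff_getElem?.1 he
    exact (hA.getElem? hi).1.nodup

theorem getD_map_sem_iff (A : List (AnnotatedGate X)) (j : ℕ) (ν : Set X) :
    (A.map fun e => e.sem ν).getD j False ↔ semAt A j ν := by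
  rw [List.getD_eq_getElem?_getD, List.getElem?_map, semAt]
  cases h : A[j]? <;> simp

theorem GateOK.eval_iff {D : Set X} {A : List (AnnotatedGate X)} {e : AnnotatedGate X}
    (h : GateOK D A e) (ν : Set X) : e.gate.eval ν (A.map fun e => e.sem ν) ↔ e.sem ν := by
  have hs := h.sound
  cases hg : e.gate with
  | var x => rw [hg] at hs; exact (hs.2.2 ν).symm
  | neg j => rw [hg] at hs; rw [hs ν, Gate.eval, getD_map_sem_iff]
  | and J => rw [hg] at hs; simp only [hs.2 ν, Gate.eval, getD_map_sem_iff]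
  | or J => rw [hg] at hs; simp only [hs.2 ν, Gate.eval, getD_map_sem_iff]

theorem Certified.foldl_eval {D : Set X} {A : List (AnnotatedGate X)} (hA : Certified D A)
    (ν : Set X) : (A.map AnnotatedGate.gate).foldl (fun v g => v ++ [g.eval ν v]) [] =
      A.map fun e => e.sem ν := by
  induction hA with
  | nil => rfl
  | snoc hA he ih =>
    simp only [List.map_append, List.map_cons, List.map_nil, List.foldl_append, List.foldl_cons,
      List.foldl_nil, ih, propext (he.eval_iff ν)]

theorem Certified.val_iff {D : Set X} {A : List (AnnotatedGate X)} (hA : Certified D A)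
    (hne : A ≠ []) (i : ℕ) (ν : Set X) : (hA.circuit hne).val i ν ↔ semAt A i ν := by
  rw [Circuit.val, Circuit.values, ← getD_map_sem_iff, ← hA.foldl_eval ν]; rfl

/-- The annotated dependency set grows along wires, so it bounds the syntactic one from above;
disjointness of annotations therefore gives decomposability. -/
theorem Certified.mem_depAt {D : Set X} {A : List (AnnotatedGate X)} (hA : Certified D A)
    (hne : A ≠ []) {i : ℕ} {x : X} (h : (hA.circuit hne).HasVar i x) : x ∈ depAt A i := by
  have key : ∀ {i : ℕ} {g : Gate X}, (hA.circuit hne).gates[i]? = some g →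
      ∃ e, A[i]? = some e ∧ e.gate = g := by
    intro i g h
    have h' : (A.map AnnotatedGate.gate)[i]? = some g := h
    rwa [List.getElem?_map, Option.map_eq_some_iff] at h'
  induction h with
  | var h =>
    obtain ⟨e, he, hg⟩ := key h
    have hs := (hA.getElem? he).1.sound
    rw [hg] at hs
    exact ⟨e, he, hs.2.1⟩
  | step h hj _ ih =>
    obtain ⟨e, he, hg⟩ := key h
    subst hg
    exact ⟨e, he, (hA.getElem? he).1.dep _ hj ih⟩

theorem Certified.isDD {D : Set X} {A : List (AnnotatedGate X)} (hA : Certified D A)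
    (hne : A ≠ []) : (hA.circuit hne).IsDD := by
  have key : ∀ {i : ℕ} {g : Gate X}, (hA.circuit hne).gates[i]? = some g →
      ∃ e, A[i]? = some e ∧ e.gate = g := by
    intro i g h
    have h' : (A.map AnnotatedGate.gate)[i]? = some g := h
    rwa [List.getElem?_map, Option.map_eq_some_iff] at h'
  constructor
  · intro i J h j₁ h₁ j₂ h₂ hj ν
    obtain ⟨e, he, hg⟩ := key h
    have hs := (hA.getElem? he).1.sound
    rw [hg] at hs
    rw [hA.val_iff, hA.val_iff]
    exact hs.1 j₁ h₁ j₂ h₂ hj ν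
  · rintro i J h j₁ h₁ j₂ h₂ hj x ⟨hx₁, hx₂⟩
    obtain ⟨e, he, hg⟩ := key h
    have hs := (hA.getElem? he).1.sound
    rw [hg] at hs
    exact hs.1 j₁ h₁ j₂ h₂ hj x ⟨hA.mem_depAt hne hx₁, hA.mem_depAt hne hx₂⟩

theorem Certified.mem_of_var {D : Set X} {A : List (AnnotatedGate X)} (hA : Certified D A)
    {x : X} (h : Gate.var x ∈ A.map AnnotatedGate.gate) : x ∈ D := by
  obtain ⟨e, he, hg⟩ := List.mem_map.1 h
  obtain ⟨i, hi⟩ := List.mem_iff_getElem?.1 he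
  have hs := (hA.getElem? hi).1.sound
  rw [hg] at hs
  exact hs.1

end Certificate

/-! ### Reasoning about programs -/

section Machine

/-- A bound for the number of steps of a program all whose loops make at most `X` rounds. -/
noncomputable def Prog.cost : Prog → Polynomial ℕ
  | .seq p q => p.cost + q.cost
  | .ite _ p q => p.cost + q.cost + 1
  | .loop _ p => Polynomial.X * (p.cost + 1) + 1
  | _ => 1

/-- Started in `σ`, the program `p` halts within its cost bound in a configuration satisfying `Q`. -/
def Reaches (n : ℕ) (p : Prog) (Q : State → Prop) (σ : State) : Prop :=
  ∃ t τ, Exec p σ t τ ∧ t ≤ p.cost.eval n ∧ Q τ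

variable {n : ℕ} {Q : State → Prop} {σ : State}

theorem Reaches.mono {p : Prog} {Q' : State → Prop} (h : Reaches n p Q σ) (hQ : ∀ τ, Q τ → Q' τ) :
    Reaches n p Q' σ := by
  obtain ⟨t, τ, h1, h2, h3⟩ := h
  exact ⟨t, τ, h1, h2, hQ _ h3⟩

theorem Reaches.const {r c : ℕ} (h : Q (σ.setReg r c)) : Reaches n (.const r c) Q σ :=
  ⟨_, _, .const σ r c, by simp [Prog.cost], h⟩

theorem Reaches.add {r s t : ℕ} (h : Q (σ.setReg r (σ.reg s + σ.reg t))) :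
    Reaches n (.add r s t) Q σ :=
  ⟨_, _, .add σ r s t, by simp [Prog.cost], h⟩

theorem Reaches.sub {r s t : ℕ} (h : Q (σ.setReg r (σ.reg s - σ.reg t))) :
    Reaches n (.sub r s t) Q σ :=
  ⟨_, _, .sub σ r s t, by simp [Prog.cost], h⟩

theorem Reaches.load {r s : ℕ} (h : Q (σ.setReg r (σ.mem (σ.reg s)))) :
    Reaches n (.load r s) Q σ :=
  ⟨_, _, .load σ r s, by simp [Prog.cost], h⟩

theorem Reaches.emit {r : ℕ} (h : Q { σ with out := σ.out ++ [σ.reg r] }) :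
    Reaches n (.emit r) Q σ :=
  ⟨_, _, .emit σ r, by simp [Prog.cost], h⟩

/-- The postcondition of the first program is the reachability claim for the second, so proofs
follow the program forwards and the time bounds add up implicitly. -/
theorem Reaches.seq {p q : Prog} (h : Reaches n p (Reaches n q Q) σ) :
    Reaches n (.seq p q) Q σ := by
  obtain ⟨t, τ, h1, h2, t', τ', h1', h2', h3⟩ := h
  exact ⟨_, _, .seq h1 h1', by simp [Prog.cost]; omega, h3⟩

theorem Reaches.ite {r : ℕ} {p q : Prog} (hp : σ.reg r ≠ 0 → Reaches n p Q σ)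
    (hq : σ.reg r = 0 → Reaches n q Q σ) : Reaches n (.ite r p q) Q σ := by
  by_cases h : σ.reg r = 0
  · obtain ⟨t, τ, h1, h2, h3⟩ := hq h
    exact ⟨_, _, .ite_false h h1, by simp [Prog.cost]; omega, h3⟩
  · obtain ⟨t, τ, h1, h2, h3⟩ := hp h
    exact ⟨_, _, .ite_true h h1, by simp [Prog.cost]; omega, h3⟩

/-- The invariant is indexed by the loop counter, which starts at `n` and drops by one in each
round. The same `n` is the argument of the cost polynomial, so exactly `n` rounds fit the bound and
nested loops multiply. -/
theorem Reaches.loop {c : ℕ} {p : Prog} (Inv : ℕ → State → Prop)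
    (hc : ∀ i σ, Inv i σ → σ.reg c = i)
    (hp : ∀ i, i < n → ∀ σ, Inv (i + 1) σ → Reaches n p (Inv i) σ) (h : Inv n σ) :
    Reaches n (.loop c p) (Inv 0) σ := by
  have key : ∀ m, m ≤ n → ∀ σ, Inv m σ → ∃ t τ, Exec (.loop c p) σ t τ ∧
      t ≤ m * (p.cost.eval n + 1) + 1 ∧ Inv 0 τ := by
    intro m
    induction m with
    | zero => intro _ σ h; exact ⟨1, σ, .loop_done (hc _ _ h), by simp, h⟩
    | succ m ih =>
      intro hm σ h
      obtain ⟨t, τ, h1, h2, h3⟩ := hp m hm σ h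
      obtain ⟨t', τ', h1', h2', h3'⟩ := ih (by omega) τ h3
      refine ⟨_, _, .loop_step (by rw [hc _ _ h]; omega) h1 h1', ?_, h3'⟩
      rw [Nat.succ_mul]; omega
  obtain ⟨t, τ, h1, h2, h3⟩ := key n le_rfl σ h
  exact ⟨t, τ, h1, by simpa [Prog.cost] using h2, h3⟩

/-- `while X_c ≠ 0 do (X_c := X_c - X_2; p)`, where `X_2 = 1`. -/
def Prog.countdown (c : ℕ) (p : Prog) : Prog := .loop c (.seq (.sub c c 2) p)

@[simp] theorem State.setReg_reg (σ : State) (r m : ℕ) :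
    (σ.setReg r m).reg = Function.update σ.reg r m := rfl
@[simp] theorem State.setReg_mem (σ : State) (r m : ℕ) : (σ.setReg r m).mem = σ.mem := rfl
@[simp] theorem State.setReg_out (σ : State) (r m : ℕ) : (σ.setReg r m).out = σ.out := rfl

/-- Write the numbers `X_r + c` for the pairs `(r, c)` of the list. -/
def emitWords : List (ℕ × ℕ) → Prog
  | [] => .const 22 0
  | (r, c) :: l => .seq (.const 22 c) (.seq (.add 22 22 r) (.seq (.emit 22) (emitWords l)))

/-- The number that a pair `(r, c)` stands for. -/
def wordVal (ρ : ℕ → ℕ) (w : ℕ × ℕ) : ℕ := ρ w.1 + w.2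

/-- Register 22 is the scratch register for each sum, so no word may refer to it. -/
theorem Reaches.emitWords {l : List (ℕ × ℕ)} (hl : ∀ w ∈ l, w.1 ≠ 22)
    (h : ∀ τ : State, τ.mem = σ.mem → (∀ r, r ≠ 22 → τ.reg r = σ.reg r) →
      τ.out = σ.out ++ l.map (wordVal σ.reg) → Q τ) : Reaches n (emitWords l) Q σ := by
  induction l generalizing σ with
  | nil =>
    refine .const (h _ rfl (fun r hr => ?_) (by simp))
    simp [Function.update_of_ne hr]
  | cons w l ih =>
    obtain ⟨r, c⟩ := w
    have hr : r ≠ 22 := hl (r, c) (by simp)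
    refine .seq (.const (.seq (.add (.seq (.emit (ih (fun w hw => hl w (by simp [hw])) ?_))))))
    intro τ h1 h2 h3
    refine h τ h1 (fun s hs => ?_) ?_
    · rw [h2 s hs]; simp [Function.update_of_ne hs]
    · rw [h3]
      have : ∀ w ∈ l, wordVal (Function.update (Function.update σ.reg 22 c) 22 (c + σ.reg r)) w =
          wordVal σ.reg w := by
        intro w hw
        have := hl w (by simp [hw])
        simp [wordVal, Function.update_of_ne this]
      simp only [State.setReg_reg, Function.update_self, Function.update_of_ne hr,
        List.map_congr_left this]
      simp [wordVal, Nat.add_comm]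

/-- `if X_a = X_b then p else q`. -/
def Prog.ifEq (a b : ℕ) (p q : Prog) : Prog :=
  .seq (.sub 22 a b) (.seq (.sub 23 b a) (.seq (.add 22 22 23) (.ite 22 q p)))

/-- The sum of the two truncated differences is zero exactly when the registers agree; hence the
zero branch of the test is `p`. The continuation is required for every state that differs in the
scratch registers 22 and 23 only. -/
theorem Reaches.ifEq {a b : ℕ} {p q : Prog} (ha : a < 22) (hb : b < 22)
    (h : ∀ τ : State, τ.mem = σ.mem → τ.out = σ.out →
      (∀ r, r ≠ 22 → r ≠ 23 → τ.reg r = σ.reg r) →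
      (σ.reg a = σ.reg b → Reaches n p Q τ) ∧ (σ.reg a ≠ σ.reg b → Reaches n q Q τ)) :
    Reaches n (.ifEq a b p q) Q σ := by
  have a1 : a ≠ 22 := by omega
  have b1 : b ≠ 22 := by omega
  refine .seq (.sub (.seq (.sub (.seq (.add ?_)))))
  have key := h ((((σ.setReg 22 (σ.reg a - σ.reg b)).setReg 23 (σ.reg b - σ.reg a))).setReg 22
      (σ.reg a - σ.reg b + (σ.reg b - σ.reg a))) rfl rfl
    (fun r h1 h2 => by simp [Function.update_of_ne, h1, h2])
  simp only [State.setReg_reg, Function.update_self, ne_eq, a1, b1, not_false_eq_true,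
    Function.update_of_ne, Nat.reduceEqDiff] at key ⊢
  refine .ite (fun h0 => key.2 ?_) (fun h0 => key.1 ?_)
  · rintro e; simp [e] at h0
  · simp at h0; omega

end Machine

/-! ### Reading the database -/

section Input

variable {k : ℕ}

/-- The number of the relation of a fact. -/
def DBFact.rel : DBFact k → ℕ
  | .R _ => 0
  | .S i _ _ => i
  | .T _ => k + 1

/-- The first argument of a fact. -/
def DBFact.arg₁ : DBFact k → ℕ
  | .R a => a
  | .S _ a _ => a
  | .T b => b

/-- The second argument of a fact, or `0`. -/
def DBFact.arg₂ : DBFact k → ℕ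
  | .R _ => 0
  | .S _ _ b => b
  | .T _ => 0

/-- The argument of a fact by which it is grouped first: the second one if the number of its
relation is less than `c`. -/
def DBFact.major (c : ℕ) (f : DBFact k) : ℕ := if c - f.rel ≠ 0 then f.arg₂ else f.arg₁

/-- The argument of a fact by which it is grouped next. -/
def DBFact.minor (c : ℕ) (f : DBFact k) : ℕ := if c - f.rel ≠ 0 then f.arg₁ else f.arg₂

theorem DBFact.code_eq (f : DBFact k) : f.code = [f.rel, f.arg₁, f.arg₂] := by cases f <;> rfl

/-- Every fact takes three words. The offset is written as a threefold sum because the machine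
cannot multiply. -/
theorem getD_flatMap_code (L : List (DBFact k)) {i : ℕ} {f : DBFact k} (h : L[i]? = some f) :
    (L.flatMap DBFact.code).getD (i + i + i) 0 = f.rel ∧
    (L.flatMap DBFact.code).getD (i + i + i + 1) 0 = f.arg₁ ∧
    (L.flatMap DBFact.code).getD (i + i + i + 2) 0 = f.arg₂ := by
  induction L generalizing i with
  | nil => simp at h
  | cons g L ih =>
    cases i with
    | zero => simp at h; subst h; simp [DBFact.code_eq]
    | succ i =>
      have := ih (i := i) (by simpa using h)
      have e : i + 1 + (i + 1) + (i + 1) = i + i + i + 3 := by omega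
      rw [e]
      simpa [DBFact.code_eq] using this

/-- The registers `X_0, X_1, X_2` and the memory are as the programs expect them. -/
structure Env (L : List (DBFact k)) (σ : State) : Prop where
  zero : σ.reg 0 = 0
  len : σ.reg 1 = L.length
  one : σ.reg 2 = 1
  mem : σ.mem = (inputState L).mem

theorem Env.mem_eq {L : List (DBFact k)} {σ : State} (h : Env L σ) {i : ℕ} {f : DBFact k}
    (hf : L[i]? = some f) : σ.mem (i + i + i + 1) = f.rel ∧ σ.mem (i + i + i + 1 + 1) = f.arg₁ ∧
      σ.mem (i + i + i + 1 + 1 + 1) = f.arg₂ := by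
  have := getD_flatMap_code L hf
  rw [h.mem]
  simpa [inputState] using this

theorem Env.congr {L : List (DBFact k)} {σ τ : State} (h : Env L σ) (hm : τ.mem = σ.mem)
    (hr : ∀ r, r ≤ 2 → τ.reg r = σ.reg r) : Env L τ :=
  ⟨(hr 0 (by omega)).trans h.zero, (hr 1 (by omega)).trans h.len, (hr 2 (by omega)).trans h.one,
    hm.trans h.mem⟩

/-- Read the fact number `X_i` into the registers `X_w, …, X_{w+2}` and its major and minor
arguments into `X_{w+3}` and `X_{w+4}`. -/
def fetch (c i w : ℕ) : Prog :=
  .seq (.add 22 i i) <| .seq (.add 22 22 i) <| .seq (.add 22 22 2) <| .seq (.load w 22) <|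
  .seq (.add 22 22 2) <| .seq (.load (w + 1) 22) <| .seq (.add 22 22 2) <|
  .seq (.load (w + 2) 22) <| .seq (.const 22 c) <| .seq (.sub 22 22 w) <|
  .ite 22 (.seq (.add (w + 3) (w + 2) 0) (.add (w + 4) (w + 1) 0))
    (.seq (.add (w + 3) (w + 1) 0) (.add (w + 4) (w + 2) 0))

variable {n : ℕ} {Q : State → Prop} {σ : State} {L : List (DBFact k)}

theorem Reaches.fetch {c i w : ℕ} {f : DBFact k} (hσ : Env L σ) (hi : i < 10) (hw : 10 ≤ w)
    (hw' : w ≤ 17) (hf : L[σ.reg i]? = some f)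
    (h : ∀ τ : State, τ.mem = σ.mem → τ.out = σ.out →
      (∀ r, r ≠ 22 → (r < w ∨ w + 5 ≤ r) → τ.reg r = σ.reg r) →
      τ.reg w = f.rel → τ.reg (w + 1) = f.arg₁ → τ.reg (w + 2) = f.arg₂ →
      τ.reg (w + 3) = f.major c → τ.reg (w + 4) = f.minor c → Q τ) :
    Reaches n (fetch c i w) Q σ := by
  obtain ⟨m0, m1, m2⟩ := hσ.mem_eq hf
  have i1 : i ≠ 22 := by omega
  have w0 : w ≠ 22 := by omega
  have w1 : w + 1 ≠ 22 := by omega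
  have w2 : w + 2 ≠ 22 := by omega
  have w3 : w + 3 ≠ 22 := by omega
  have w4 : w + 4 ≠ 22 := by omega
  have z0 : w ≠ 0 := by omega
  have u0 : w ≠ 2 := by omega
  have u1 : w + 1 ≠ 2 := by omega
  have u2 : w + 2 ≠ 2 := by omega
  refine .seq (.add (.seq (.add (.seq (.add (.seq (.load (.seq (.add (.seq (.load (.seq (.add (.seq
    (.load (.seq (.const (.seq (.sub (.ite (fun h0 => .seq (.add (.add ?_)))
      (fun h0 => .seq (.add (.add ?_)))))))))))))))))))))))
  all_goals
    simp [i1, w0, w1, w2, w0.symm, w1.symm, z0, z0.symm, u0.symm, u1.symm, hσ.one, hσ.zero, m0, m1, m2] at h0 ⊢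
    refine h _ rfl rfl (fun r h1 h2 => ?_) ?_ ?_ ?_ ?_ ?_
    · simp [h1, show r ≠ w by omega, show r ≠ w + 1 by omega, show r ≠ w + 2 by omega,
        show r ≠ w + 3 by omega, show r ≠ w + 4 by omega]
    all_goals simp [DBFact.major, DBFact.minor, h0, w0, w1, w2]

/-- Compute into `X_15` and `X_16` the least number of a fact with the major argument `X_13` and of
a fact with the minor argument `X_14`. -/
def scan (c : ℕ) : Prog :=
  .seq (.add 15 1 0) <| .seq (.add 16 1 0) <| .seq (.add 9 1 0) <|
  .countdown 9 (.seq (fetch c 9 17) <|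
    .seq (.ifEq 20 13 (.add 15 9 0) (.add 15 15 0)) (.ifEq 21 14 (.add 16 9 0) (.add 16 16 0)))

/-- The number of the first fact in `L` with the same major argument as `f`. -/
def majorIdx (c : ℕ) (L : List (DBFact k)) (f : DBFact k) : ℕ :=
  L.findIdx fun g => g.major c = f.major c

/-- The number of the first fact in `L` with the same minor argument as `f`. -/
def minorIdx (c : ℕ) (L : List (DBFact k)) (f : DBFact k) : ℕ :=
  L.findIdx fun g => g.minor c = f.minor c

/-- The positions are visited downwards and each match overwrites the previous one, so the least
match survives. The result registers start at the length of `L`, which is also what `findIdx`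
returns when there is no match. -/
theorem Reaches.scan {c : ℕ} {f : DBFact k} (hσ : Env L σ)
    (hu : σ.reg 13 = f.major c) (hv : σ.reg 14 = f.minor c)
    (h : ∀ τ : State, τ.mem = σ.mem → τ.out = σ.out →
      (∀ r, r ≠ 9 → (r < 15 ∨ 23 < r) → τ.reg r = σ.reg r) →
      τ.reg 15 = majorIdx c L f → τ.reg 16 = minorIdx c L f → Q τ) :
    Reaches L.length (scan c) Q σ := by
  -- After the positions from `i` on have been visited, the registers hold the first match in the
  -- remaining suffix, shifted back to a position in `L`.
  let Inv : ℕ → State → Prop := fun i τ => τ.mem = σ.mem ∧ τ.out = σ.out ∧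
    (∀ r, r ≠ 9 → (r < 15 ∨ 23 < r) → τ.reg r = σ.reg r) ∧ τ.reg 9 = i ∧
    τ.reg 15 = i + (L.drop i).findIdx (fun g => g.major c = f.major c) ∧
    τ.reg 16 = i + (L.drop i).findIdx (fun g => g.minor c = f.minor c)
  refine .seq (.add (.seq (.add (.seq (.add ?_)))))
  refine Reaches.mono (Reaches.loop Inv (fun i τ hτ => hτ.2.2.2.1) ?_ ?_) ?_
  · rintro i hi τ ⟨h1, h2, h3, h4, h5, h6⟩
    obtain ⟨g, hg⟩ : ∃ g, L[i]? = some g := ⟨_, List.getElem?_eq_getElem hi⟩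
    have hd : L.drop i = g :: L.drop (i + 1) := by
      rw [List.getElem?_eq_some_iff] at hg
      obtain ⟨hi, rfl⟩ := hg
      exact List.drop_eq_getElem_cons hi
    have hone : τ.reg 2 = 1 := by rw [h3 2 (by omega) (by omega), hσ.one]
    refine .seq (.sub (.seq (Reaches.fetch (L := L) (f := g) ?_ (by omega) (by omega) (by omega)
      ?_ ?_)))
    · refine hσ.congr h1 fun r hr => ?_
      have : r ≠ 9 := by omega
      simp only [State.setReg_reg, Function.update_of_ne this]
      exact h3 r this (by omega)
    · simp [h4, hone, hg]
    intro τ₁ a1 a2 a3 a4 a5 a6 a7 a8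
    refine .seq (.ifEq (by omega) (by omega) fun τ₂ b1 b2 b3 => ?_)
    have r20 : τ₁.reg 20 = g.major c := a7
    have r21 : τ₁.reg 21 = g.minor c := a8
    have r13 : τ₁.reg 13 = f.major c := by rw [a3 13 (by omega) (by omega)]; simp [h3, hu]
    have r14 : τ₁.reg 14 = f.minor c := by rw [a3 14 (by omega) (by omega)]; simp [h3, hv]
    have r0 : τ₂.reg 0 = 0 := by
      rw [b3 0 (by omega) (by omega), a3 0 (by omega) (by omega)]; simp [h3, hσ.zero]
    have r9 : τ₂.reg 9 = i := by
      rw [b3 9 (by omega) (by omega), a3 9 (by omega) (by omega)]; simp [h4, hone]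
    have r15 : τ₂.reg 15 = i + 1 + (L.drop (i + 1)).findIdx (fun g => g.major c = f.major c) := by
      rw [b3 15 (by omega) (by omega), a3 15 (by omega) (by omega), ← h5]; simp
    have r16 : τ₂.reg 16 = i + 1 + (L.drop (i + 1)).findIdx (fun g => g.minor c = f.minor c) := by
      rw [b3 16 (by omega) (by omega), a3 16 (by omega) (by omega), ← h6]; simp
    have fr : ∀ r, r ≠ 9 → (r < 15 ∨ 23 < r) → τ₂.reg r = σ.reg r := by
      intro r hr hr'
      rw [b3 r (by omega) (by omega), a3 r (by omega) (by omega)]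
      simpa [Function.update_of_ne hr] using h3 r hr hr'
    have step : ∀ τ₃ : State, τ₃.mem = τ₂.mem → τ₃.out = τ₂.out →
        (∀ r, r ≠ 15 → τ₃.reg r = τ₂.reg r) →
        τ₃.reg 15 = i + (L.drop i).findIdx (fun g => g.major c = f.major c) →
        Reaches L.length (.ifEq 21 14 (.add 16 9 0) (.add 16 16 0)) (Inv i) τ₃ := by
      intro τ₃ c1 c2 c3 c4
      refine .ifEq (by omega) (by omega) fun τ₄ d1 d2 d3 => ?_
      have e21 : τ₃.reg 21 = g.minor c := by
        rw [c3 21 (by omega), b3 21 (by omega) (by omega), r21]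
      have e14 : τ₃.reg 14 = f.minor c := by
        rw [c3 14 (by omega), b3 14 (by omega) (by omega), r14]
      have fin : ∀ m, m = i + (L.drop i).findIdx (fun g => g.minor c = f.minor c) →
          Inv i (τ₄.setReg 16 m) := by
        intro m hm
        refine ⟨?_, ?_, fun r hr hr' => ?_, ?_, ?_, ?_⟩
        · simp [d1, c1, b1, a1, h1]
        · simp [d2, c2, b2, a2, h2]
        · have : r ≠ 16 := by omega
          simp only [State.setReg_reg, Function.update_of_ne this]
          rw [d3 r (by omega) (by omega), c3 r (by omega), fr r hr hr']
        · simp [d3, c3, r9]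
        · simp [d3, c4]
        · simp [hm]
      rw [e21, e14]
      refine ⟨fun he => .add (fin _ ?_), fun he => .add (fin _ ?_)⟩
      · simp [d3, c3, r9, r0, hd, List.findIdx_cons, he]
      · simp [d3, c3, r16, r0, hd, List.findIdx_cons, he]; omega
    rw [r20, r13]
    refine ⟨fun he => .add (step _ rfl rfl (fun r hr => ?_) ?_),
      fun he => .add (step _ rfl rfl (fun r hr => ?_) ?_)⟩
    · simp [Function.update_of_ne hr]
    · simp [r9, r0, hd, List.findIdx_cons, he]
    · simp [Function.update_of_ne hr]
    · simp [r15, r0, hd, List.findIdx_cons, he]; omega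
  · refine ⟨rfl, rfl, fun r hr hr' => ?_, ?_, ?_, ?_⟩
    · simp [show r ≠ 9 from hr, show r ≠ 15 by omega, show r ≠ 16 by omega]
    · simp [hσ.len, hσ.zero]
    · simp [hσ.len, hσ.zero]
    · simp [hσ.len, hσ.zero]
  · rintro τ ⟨h1, h2, h3, h4, h5, h6⟩
    exact h τ h1 h2 h3 (by simpa [majorIdx] using h5) (by simpa [minorIdx] using h6)

end Input

/-! ### Circuits that simulate an automaton -/

section Layers

variable {X : Type} {m : ℕ} {D : Set X} {A : List (AnnotatedGate X)} {S : ℕ} {st : Set X → Fin m}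
  {d : Set X}

theorem semAt_append_right (A B : List (AnnotatedGate X)) (j : ℕ) :
    semAt (A ++ B) (A.length + j) = semAt B j := by
  funext ν; simp only [semAt, List.getElem?_append_right (Nat.le_add_right _ _),
    Nat.add_sub_cancel_left]

theorem depAt_append_right (A B : List (AnnotatedGate X)) (j : ℕ) :
    depAt (A ++ B) (A.length + j) = depAt B j := by
  simp only [depAt, List.getElem?_append_right (Nat.le_add_right _ _), Nat.add_sub_cancel_left]

theorem semAt_iff {j : ℕ} {e : AnnotatedGate X} (h : A[j]? = some e) (ν : Set X) :
    semAt A j ν ↔ e.sem ν := by simp [semAt, h]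

theorem depAt_eq {j : ℕ} {e : AnnotatedGate X} (h : A[j]? = some e) : depAt A j = e.dep := by
  simp [depAt, h]

/-- The last `m` gates of `A`, which start at position `S`, depend on `d` only, and the gate number
`S + i` tells whether the automaton is in the state `i`; its state is given by `st`. -/
structure HasStates (A : List (AnnotatedGate X)) (S : ℕ) (st : Set X → Fin m) (d : Set X) :
    Prop where
  length : A.length = S + m
  sem : ∀ (i : Fin m) (ν : Set X), semAt A (S + i) ν ↔ st ν = i
  dep : ∀ i : Fin m, depAt A (S + i) = d

/-- The gates for the states of the automaton. -/
def stateGates (g : Fin m → Gate X) (st : Set X → Fin m) (d : Set X) : List (AnnotatedGate X) :=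
  (List.finRange m).map fun i => ⟨g i, fun ν => st ν = i, d⟩

theorem getElem?_stateGates (g : Fin m → Gate X) (st : Set X → Fin m) (d : Set X) (i : Fin m) :
    (stateGates g st d)[(i : ℕ)]? = some ⟨g i, fun ν => st ν = i, d⟩ := by
  simp [stateGates]

theorem hasStates_append (A : List (AnnotatedGate X)) (g : Fin m → Gate X) (st : Set X → Fin m)
    (d : Set X) : HasStates (A ++ stateGates g st d) A.length st d where
  length := by simp [stateGates]
  sem i ν := by rw [semAt_append_right, semAt_iff (getElem?_stateGates g st d i)]
  dep i := by rw [depAt_append_right, depAt_eq (getElem?_stateGates g st d i)]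

/-- The gate for the state `i` of the initial layer. -/
def initialGate (q₀ i : Fin m) : Gate X := if q₀ = i then .and [] else .or []

theorem certified_initial (hA : Certified D A) (q₀ : Fin m) :
    Certified D (A ++ stateGates (initialGate q₀) (fun _ => q₀) ∅) := by
  refine hA.append _ fun e he => ?_
  obtain ⟨i, -, rfl⟩ := List.mem_map.1 he
  by_cases h : q₀ = i
  · refine ⟨?_, ?_, ?_, ?_⟩ <;> simp [initialGate, h, Gate.inputs, GateSound]
  · refine ⟨?_, ?_, ?_, ?_⟩ <;> simp [initialGate, h, Gate.inputs, GateSound]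

/-- The positions, starting from `S`, of the states that `g` maps to `i`. -/
def preimage {β : Type} [DecidableEq β] (g : Fin m → β) (S : ℕ) (i : β) : List ℕ :=
  ((List.finRange m).filter fun j => g j = i).map fun j : Fin m => S + (j : ℕ)

theorem mem_preimage {β : Type} [DecidableEq β] {g : Fin m → β} {i : β} {a : ℕ} :
    a ∈ preimage g S i ↔ ∃ j : Fin m, g j = i ∧ S + j = a := by
  simp [preimage]

theorem nodup_preimage {β : Type} [DecidableEq β] (g : Fin m → β) (S : ℕ) (i : β) :
     (preimage g S i).Nodup := by
  refine List.Nodup.map (fun a b h => ?_) ((List.nodup_finRange m).filter _)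
  exact Fin.ext (by simpa using h)

/-- Distinct state gates are mutually exclusive, so the disjunction over the preimage of a state is
deterministic. -/
theorem certified_map (hA : Certified D A) (hS : HasStates A S st d) (g : Fin m → Fin m) :
    Certified D (A ++ stateGates (fun i => .or (preimage g S i)) (fun ν => g (st ν)) d) := by
  refine hA.append _ fun e he => ?_
  obtain ⟨i, -, rfl⟩ := List.mem_map.1 he
  refine ⟨fun a ha => ?_, nodup_preimage g S i, fun a ha => ?_, fun a ha b hb hab ν => ?_,
    fun ν => ?_⟩
  · obtain ⟨j, -, rfl⟩ := mem_preimage.1 ha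
    rw [hS.length]; omega
  · obtain ⟨j, -, rfl⟩ := mem_preimage.1 ha
    rw [hS.dep]
  · obtain ⟨j, -, rfl⟩ := mem_preimage.1 ha
    obtain ⟨j', -, rfl⟩ := mem_preimage.1 hb
    rw [hS.sem, hS.sem]
    rintro ⟨h1, h2⟩
    exact hab (by rw [← h1, ← h2])
  · constructor
    · intro h
      exact ⟨S + st ν, mem_preimage.2 ⟨_, h, rfl⟩, (hS.sem _ ν).2 rfl⟩
    · rintro ⟨a, ha, h⟩
      obtain ⟨j, hj, rfl⟩ := mem_preimage.1 ha
      rw [hS.sem] at h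
      simpa [h] using hj

/-- The gates for the conjunctions of the states with a literal. -/
def literalGates (S a : ℕ) (st : Set X → Fin m) (lit : Set X → Prop) (d : Set X) :
    List (AnnotatedGate X) :=
  (List.finRange m).map fun i : Fin m => ⟨.and [S + (i : ℕ), a], fun ν => st ν = i ∧ lit ν, d⟩

theorem getElem?_literalGates (S a : ℕ) (st : Set X → Fin m) (lit : Set X → Prop) (d : Set X)
    (i : Fin m) : (literalGates S a st lit d)[(i : ℕ)]? =
      some ⟨.and [S + i, a], fun ν => st ν = i ∧ lit ν, d⟩ := by
  simp [literalGates]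

theorem length_literalGates (S a : ℕ) (st : Set X → Fin m) (lit : Set X → Prop) (d : Set X) :
    (literalGates S a st lit d).length = m := by simp [literalGates]

/-- The state of the automaton after reading the fact `x`. -/
noncomputable def readState (δ : Fin m → Fin m) (x : X) (st : Set X → Fin m) (ν : Set X) : Fin m :=
  open Classical in if x ∈ ν then δ (st ν) else st ν

/-- The gates simulating a transition of the automaton that reads the variable `x`. -/
def readBlock (S : ℕ) (x : X) (st : Set X → Fin m) (d : Set X) : List (AnnotatedGate X) :=
  ⟨.var x, fun ν => x ∈ ν, {x}⟩ :: ⟨.neg (S + m), fun ν => x ∉ ν, {x}⟩ ::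
    (literalGates S (S + m) st (fun ν => x ∈ ν) (insert x d) ++
      literalGates S (S + m + 1) st (fun ν => x ∉ ν) (insert x d))

theorem length_readBlock (S : ℕ) (x : X) (st : Set X → Fin m) (d : Set X) :
    (readBlock S x st d).length = 2 * m + 2 := by
  simp [readBlock, length_literalGates]; omega

theorem certified_readBlock (hA : Certified D A) (hS : HasStates A S st d) {x : X} (hx : x ∈ D)
    (hd : x ∉ d) : Certified D (A ++ readBlock S x st d) := by
  have h1 : Certified D (A ++ [⟨.var x, fun ν => x ∈ ν, {x}⟩]) :=
    hA.snoc ⟨by simp [Gate.inputs], by simp [Gate.inputs], by simp [Gate.inputs],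
      by simp [GateSound, hx]⟩
  have hlen : (A ++ [(⟨.var x, fun ν => x ∈ ν, {x}⟩ : AnnotatedGate X)]).length = S + m + 1 := by
    simp [hS.length]
  have hv : (A ++ [⟨.var x, fun ν => x ∈ ν, {x}⟩])[S + m]? =
      some (⟨.var x, fun ν => x ∈ ν, {x}⟩ : AnnotatedGate X) := by
    rw [← hS.length]; simp
  have h2 := h1.snoc (e := ⟨.neg (S + m), fun ν => x ∉ ν, {x}⟩)
    ⟨by simp [Gate.inputs, hS.length], by simp [Gate.inputs],
      by intro j hj; simp only [Gate.inputs, List.mem_singleton] at hj; subst hj; rw [depAt_eq hv],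
      fun ν => by rw [semAt_iff hv]⟩
  set A₁ := A ++ [⟨.var x, fun ν => x ∈ ν, {x}⟩] with hA₁
  set A₂ := A₁ ++ [(⟨.neg (S + m), fun ν => x ∉ ν, {x}⟩ : AnnotatedGate X)] with hA₂
  have e2 : A₂ = A ++ [⟨.var x, fun ν => x ∈ ν, {x}⟩, ⟨.neg (S + m), fun ν => x ∉ ν, {x}⟩] := by
    simp [hA₂, hA₁]
  have hv2 : A₂[S + m]? = some (⟨.var x, fun ν => x ∈ ν, {x}⟩ : AnnotatedGate X) := by
    rw [hA₂, List.getElem?_append_left (by omega), hv]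
  have hn2 : A₂[S + m + 1]? = some (⟨.neg (S + m), fun ν => x ∉ ν, {x}⟩ : AnnotatedGate X) := by
    rw [hA₂, ← hlen]; simp
  have hlen2 : A₂.length = S + m + 2 := by rw [hA₂]; simp [hlen]
  have key : ∀ (a : ℕ) (lit : Set X → Prop), S + m ≤ a → a < S + m + 2 →
      (∀ ν, semAt A₂ a ν ↔ lit ν) → depAt A₂ a = {x} →
      ∀ e ∈ literalGates S a st lit (insert x d), GateOK D A₂ e := by
    intro a lit ha ha' hs hdep e he
    obtain ⟨i, -, rfl⟩ := List.mem_map.1 he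
    have hi : S + i < A.length := by rw [hS.length]; omega
    have si : ∀ ν, semAt A₂ (S + i) ν ↔ st ν = i := by
      intro ν; rw [e2, semAt_append_left hi, hS.sem]
    have di : depAt A₂ (S + i) = d := by rw [e2, depAt_append_left hi, hS.dep]
    refine ⟨?_, ?_, ?_, ?_, fun ν => ?_⟩
    · simp [Gate.inputs, hlen2]; omega
    · simp [Gate.inputs]; omega
    · simp [Gate.inputs, di, hdep]
    -- Decomposability: the state gate depends on `d`, the literal on `x` alone, and `x` is not in
    -- `d`.
    · have hne : S + i ≠ a := by omega
      simp [di, hdep, hd]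
      exact fun _ => fun y hy e => hd (e ▸ hy)
    · simp [si, hs]
  have h3 := h2.append (literalGates S (S + m) st (fun ν => x ∈ ν) (insert x d) ++
      literalGates S (S + m + 1) st (fun ν => x ∉ ν) (insert x d)) (by
    intro e he
    rcases List.mem_append.1 he with he | he
    · exact key _ _ (by omega) (by omega) (fun ν => by rw [semAt_iff hv2]) (depAt_eq hv2) e he
    · exact key _ _ (by omega) (by omega) (fun ν => by rw [semAt_iff hn2]) (depAt_eq hn2) e he)
  rw [e2] at h3
  simpa [readBlock] using h3

/-- The gate for the state `i` after reading a variable. -/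
def readGate (δ : Fin m → Fin m) (S : ℕ) (i : Fin m) : Gate X :=
  .or ((S + (2 * m + 2) + i) :: preimage δ (S + (m + 2)) i)

/-- The automaton ends in state `i` either by reading a present `x` in a state that `δ` sends to
`i`, or by staying in `i` because `x` is absent. These alternatives exclude one another and each is
a conjunction written in the preceding block. -/
theorem certified_read (hA : Certified D A) (hS : HasStates A S st d) (δ : Fin m → Fin m) {x : X}
    (hx : x ∈ D) (hd : x ∉ d) :
    Certified D (A ++ (readBlock S x st d ++
      stateGates (readGate δ S) (readState δ x st) (insert x d))) := by
  rw [← List.append_assoc]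
  refine (certified_readBlock hA hS hx hd).append _ fun e he => ?_
  obtain ⟨i, -, rfl⟩ := List.mem_map.1 he
  -- Layout from `S`: the `m` old state gates, the variable at `S + m`, its negation at `S + m + 1`,
  -- then `m` conjunctions with the variable and `m` with its negation. The new states start at `S +
  -- (3 * m + 2)`.
  have hpos : ∀ j : Fin m, (A ++ readBlock S x st d)[S + (m + 2) + j]? =
      some ⟨.and [S + j, S + m], fun ν => st ν = j ∧ x ∈ ν, insert x d⟩ := by
    intro j
    have hl := length_literalGates S (S + m) st (fun ν => x ∈ ν) (insert x d)
    rw [List.getElem?_append_right (by rw [hS.length]; omega), hS.length, readBlock,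
      show S + (m + 2) + (j : ℕ) - (S + m) = j + 1 + 1 by omega, List.getElem?_cons_succ,
      List.getElem?_cons_succ, List.getElem?_append_left (by omega), getElem?_literalGates]
  have hneg : ∀ j : Fin m, (A ++ readBlock S x st d)[S + (2 * m + 2) + j]? =
      some ⟨.and [S + j, S + m + 1], fun ν => st ν = j ∧ x ∉ ν, insert x d⟩ := by
    intro j
    have hl := length_literalGates S (S + m) st (fun ν => x ∈ ν) (insert x d)
    rw [List.getElem?_append_right (by rw [hS.length]; omega), hS.length, readBlock,
      show S + (2 * m + 2) + (j : ℕ) - (S + m) = m + j + 1 + 1 by omega, List.getElem?_cons_succ,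
      List.getElem?_cons_succ, List.getElem?_append_right (by omega), hl, Nat.add_sub_cancel_left,
      getElem?_literalGates]
  have hlen : (A ++ readBlock S x st d).length = S + (3 * m + 2) := by
    rw [List.length_append, length_readBlock, hS.length]; omega
  refine ⟨fun a ha => ?_, ?_, fun a ha => ?_, fun a ha b hb hab ν => ?_, fun ν => ?_⟩
  · rw [hlen]
    rcases List.mem_cons.1 ha with rfl | ha
    · omega
    · obtain ⟨j, -, rfl⟩ := mem_preimage.1 ha; omega
  · refine List.nodup_cons.2 ⟨fun ha => ?_, nodup_preimage _ _ _⟩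
    obtain ⟨j, -, h⟩ := mem_preimage.1 ha; omega
  · rcases List.mem_cons.1 ha with rfl | ha
    · rw [depAt_eq (hneg i)]
    · obtain ⟨j, -, rfl⟩ := mem_preimage.1 ha; rw [depAt_eq (hpos j)]
  -- Mixed inputs disagree on `x`; two positive ones require different old states.
  · rcases List.mem_cons.1 ha with rfl | ha <;> rcases List.mem_cons.1 hb with rfl | hb
    · exact absurd rfl hab
    · obtain ⟨j, -, rfl⟩ := mem_preimage.1 hb
      rw [semAt_iff (hneg i), semAt_iff (hpos j)]; tauto
    · obtain ⟨j, -, rfl⟩ := mem_preimage.1 ha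
      rw [semAt_iff (hneg i), semAt_iff (hpos j)]; tauto
    · obtain ⟨j, -, rfl⟩ := mem_preimage.1 ha
      obtain ⟨j', -, rfl⟩ := mem_preimage.1 hb
      rw [semAt_iff (hpos j), semAt_iff (hpos j')]
      rintro ⟨⟨h1, -⟩, h2, -⟩
      exact hab (by rw [← h1, ← h2])
  · by_cases hν : x ∈ ν
    · simp only [readState, hν, if_true]
      constructor
      · intro h
        exact ⟨_, List.mem_cons_of_mem _ (mem_preimage.2 ⟨st ν, h, rfl⟩),
          (semAt_iff (hpos _) ν).2 ⟨rfl, hν⟩⟩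
      · rintro ⟨a, ha, h⟩
        rcases List.mem_cons.1 ha with rfl | ha
        · rw [semAt_iff (hneg i)] at h; exact absurd hν h.2
        · obtain ⟨j, hj, rfl⟩ := mem_preimage.1 ha
          rw [semAt_iff (hpos j)] at h
          simpa [h.1] using hj
    · simp only [readState, hν, if_false]
      constructor
      · intro h
        exact ⟨_, List.mem_cons_self, (semAt_iff (hneg i) ν).2 ⟨h, hν⟩⟩
      · rintro ⟨a, ha, h⟩
        rcases List.mem_cons.1 ha with rfl | ha
        · rw [semAt_iff (hneg i)] at h; exact h.1
        · obtain ⟨j, hj, rfl⟩ := mem_preimage.1 ha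
          rw [semAt_iff (hpos j)] at h
          exact absurd h.2 hν

end Layers

/-! ### Programs that write layers of gates -/

section LayerPrograms

variable {k m n : ℕ} {Q : State → Prop} {σ : State} {A : List (AnnotatedGate (DBFact k))}

/-- The encoding of a list of gates. -/
def gatesCode (A : List (AnnotatedGate (DBFact k))) : List ℕ := A.flatMap fun e => e.gate.code

/-- The words of an `∧`-gate. -/
def andWords (J : List (ℕ × ℕ)) : List (ℕ × ℕ) := (0, 2) :: (0, J.length) :: J

/-- The words of an `∨`-gate. -/
def orWords (J : List (ℕ × ℕ)) : List (ℕ × ℕ) := (0, 3) :: (0, J.length) :: J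

/-- The words of a `¬`-gate. -/
def negWords (a : ℕ × ℕ) : List (ℕ × ℕ) := [(0, 1), a]

theorem map_wordVal_andWords {ρ : ℕ → ℕ} (h : ρ 0 = 0) (J : List (ℕ × ℕ)) :
    (andWords J).map (wordVal ρ) = (Gate.and (X := DBFact k) (J.map (wordVal ρ))).code := by
  simp [andWords, Gate.code, wordVal, h]

theorem map_wordVal_orWords {ρ : ℕ → ℕ} (h : ρ 0 = 0) (J : List (ℕ × ℕ)) :
    (orWords J).map (wordVal ρ) = (Gate.or (X := DBFact k) (J.map (wordVal ρ))).code := by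
  simp [orWords, Gate.code, wordVal, h]

theorem map_wordVal_negWords {ρ : ℕ → ℕ} (h : ρ 0 = 0) (a : ℕ × ℕ) :
    (negWords a).map (wordVal ρ) = (Gate.neg (X := DBFact k) (wordVal ρ a)).code := by
  simp [negWords, Gate.code, wordVal, h]

/-- Write some gates and advance `X_3` by `c`. -/
def writeGates (l : List (ℕ × ℕ)) (c : ℕ) : Prog :=
  .seq (emitWords l) (.seq (.const 22 c) (.add 3 3 22))

/-- The words are evaluated before `X_3` is advanced, so positions in them are relative to its old
value. -/
theorem Reaches.writeGates {l : List (ℕ × ℕ)} {c : ℕ} {B : List (AnnotatedGate (DBFact k))}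
    (hl : ∀ w ∈ l, w.1 ≠ 22) (hB : l.map (wordVal σ.reg) = gatesCode B)
    (hout : σ.out = gatesCode A)
    (h : ∀ τ : State, τ.mem = σ.mem → (∀ r, r ≠ 22 → r ≠ 3 → τ.reg r = σ.reg r) →
      τ.reg 3 = σ.reg 3 + c → τ.out = gatesCode (A ++ B) → Q τ) :
    Reaches n (writeGates l c) Q σ := by
  refine .seq (.emitWords hl fun τ h1 h2 h3 => .seq (.const (.add (h _ ?_ ?_ ?_ ?_))))
  · simp [h1]
  · intro r hr hr'; simp [Function.update_of_ne, hr, hr', h2 r hr]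
  · simp [h2 3]
  · simp [h3, hB, hout, gatesCode]

/-- The words of the initial layer. -/
def initialWords (q₀ : Fin m) : List (ℕ × ℕ) :=
  (List.finRange m).flatMap fun i => if q₀ = i then andWords [] else orWords []

/-- The positions, relative to `X_3 + S`, of the states that `g` maps to `i`. -/
def preimageWords {β : Type} [DecidableEq β] (g : Fin m → β) (S : ℕ) (i : β) :
     List (ℕ × ℕ) :=
  (preimage g S i).map fun a => (3, a)

/-- The words of a layer that replaces the state `s` by `g s`. -/
def mapWords (g : Fin m → Fin m) : List (ℕ × ℕ) :=
  (List.finRange m).flatMap fun i => orWords (preimageWords g 0 i)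

/-- The words of a layer that reads the fact in `X_10, X_11, X_12`. -/
def readWords (δ : Fin m → Fin m) : List (ℕ × ℕ) :=
  [(0, 0), (10, 0), (11, 0), (12, 0)] ++ (negWords (3, m) ++
    (((List.finRange m).flatMap fun i : Fin m => andWords [(3, (i : ℕ)), (3, m)]) ++
    (((List.finRange m).flatMap fun i : Fin m => andWords [(3, (i : ℕ)), (3, m + 1)]) ++
    (List.finRange m).flatMap fun i : Fin m =>
      orWords ((3, 2 * m + 2 + (i : ℕ)) :: preimageWords δ (m + 2) i))))

theorem gatesCode_append (A B : List (AnnotatedGate (DBFact k))) :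
    gatesCode (A ++ B) = gatesCode A ++ gatesCode B := by simp [gatesCode]

theorem gatesCode_stateGates (g : Fin m → Gate (DBFact k)) (st : Set (DBFact k) → Fin m)
    (d : Set (DBFact k)) :
    gatesCode (stateGates g st d) = (List.finRange m).flatMap fun i => (g i).code := by
  simp [gatesCode, stateGates, List.flatMap_map]

theorem gatesCode_literalGates (S a : ℕ) (st : Set (DBFact k) → Fin m)
    (lit : Set (DBFact k) → Prop) (d : Set (DBFact k)) :
    gatesCode (literalGates S a st lit d) = (List.finRange m).flatMap fun i : Fin m =>
      (Gate.and (X := DBFact k) [S + (i : ℕ), a]).code := by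
  simp [gatesCode, literalGates, List.flatMap_map]

theorem map_wordVal_initialWords {ρ : ℕ → ℕ} (h : ρ 0 = 0) (q₀ : Fin m)
    (st : Set (DBFact k) → Fin m) (d : Set (DBFact k)) :
    (initialWords q₀).map (wordVal ρ) = gatesCode (stateGates (initialGate q₀) st d) := by
  rw [gatesCode_stateGates, initialWords, List.map_flatMap]
  refine List.flatMap_congr fun i _ => ?_
  simp only [initialGate]
  split_ifs
  · exact map_wordVal_andWords h []
  · exact map_wordVal_orWords h []

theorem map_wordVal_preimageWords {β : Type} [DecidableEq β] (ρ : ℕ → ℕ) (g : Fin m → β) (S : ℕ)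
    (i : β) :
    (preimageWords g S i).map (wordVal ρ) = preimage g (ρ 3 + S) i := by
  simp [preimageWords, preimage, wordVal, Function.comp_def, Nat.add_assoc]

theorem map_wordVal_mapWords {ρ : ℕ → ℕ} (h : ρ 0 = 0) (g : Fin m → Fin m)
    (st : Set (DBFact k) → Fin m) (d : Set (DBFact k)) :
    (mapWords g).map (wordVal ρ) =
      gatesCode (stateGates (fun i => .or (preimage g (ρ 3) i)) st d) := by
  rw [gatesCode_stateGates, mapWords, List.map_flatMap]
  refine List.flatMap_congr fun i _ => ?_
  rw [map_wordVal_orWords h, map_wordVal_preimageWords, Nat.add_zero]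

theorem map_wordVal_readWords {ρ : ℕ → ℕ} (h : ρ 0 = 0) (δ : Fin m → Fin m) {f : DBFact k}
    (h0 : ρ 10 = f.rel) (h1 : ρ 11 = f.arg₁) (h2 : ρ 12 = f.arg₂)
    (st st' : Set (DBFact k) → Fin m) (d d' : Set (DBFact k)) :
    (readWords δ).map (wordVal ρ) =
      gatesCode (readBlock (ρ 3) f st d ++ stateGates (readGate δ (ρ 3)) st' d') := by
  have e1 : gatesCode (readBlock (ρ 3) f st d) = (Gate.var f).code ++
      ((Gate.neg (X := DBFact k) (ρ 3 + m)).code ++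
        (gatesCode (literalGates (ρ 3) (ρ 3 + m) st (fun ν => f ∈ ν) (insert f d)) ++
        gatesCode (literalGates (ρ 3) (ρ 3 + m + 1) st (fun ν => f ∉ ν) (insert f d)))) := by
    simp [readBlock, gatesCode]
  rw [gatesCode_append, e1, gatesCode_stateGates, readWords, gatesCode_literalGates,
    gatesCode_literalGates]
  simp only [List.map_append, List.append_assoc, List.map_flatMap, map_wordVal_andWords (k := k) h,
    map_wordVal_orWords (k := k) h, map_wordVal_negWords (k := k) h]
  simp only [List.map_cons, map_wordVal_preimageWords, readGate]
  simp [wordVal, h, h0, h1, h2, Gate.code, DBFact.code_eq, Nat.add_assoc]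

/-- The output encodes a certified circuit that extends `A₀` and ends in a layer of state gates,
starting at position `X_3`. -/
def Layered (D : Set (DBFact k)) (A₀ : List (AnnotatedGate (DBFact k)))
    (st : Set (DBFact k) → Fin m) (d : Set (DBFact k)) (σ : State) : Prop :=
  ∃ A, A₀ <+: A ∧ Certified D A ∧ σ.out = gatesCode A ∧ HasStates A (σ.reg 3) st d

variable {D : Set (DBFact k)} {A₀ : List (AnnotatedGate (DBFact k))}
  {st : Set (DBFact k) → Fin m} {d : Set (DBFact k)}

theorem Layered.congr (h : Layered D A₀ st d σ) {τ : State} (hout : τ.out = σ.out)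
    (hr : τ.reg 3 = σ.reg 3) : Layered D A₀ st d τ := by
  rw [Layered, hout, hr]; exact h

theorem mem_preimageWords_ne {β : Type} [DecidableEq β] {g : Fin m → β} {S : ℕ} {i : β} {w : ℕ × ℕ}
    (h : w ∈ preimageWords g S i) : w.1 ≠ 22 := by
  obtain ⟨a, -, rfl⟩ := List.mem_map.1 h; simp

/-- Here `X_3` is the size of `A`, already the start of the new layer, so it advances by 0. In later
steps it points to the preceding state layer and must move past that layer and any auxiliary gates.
-/
theorem Reaches.initial {q₀ : Fin m} (h0 : σ.reg 0 = 0) (hA : Certified D A)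
    (hout : σ.out = gatesCode A) (h3 : σ.reg 3 = A.length)
    (h : ∀ τ : State, τ.mem = σ.mem → (∀ r, r ≠ 22 → r ≠ 3 → τ.reg r = σ.reg r) →
      Layered D A (fun _ => q₀) ∅ τ → Q τ) :
    Reaches n (HQueries.writeGates (initialWords q₀) 0) Q σ := by
  refine .writeGates ?_ (map_wordVal_initialWords h0 q₀ (fun _ => q₀) ∅) hout
    fun τ h1 h2 h4 h5 => h τ h1 h2 ?_
  · intro w hw
    obtain ⟨i, -, hw⟩ := List.mem_flatMap.1 hw
    split_ifs at hw <;> simp [andWords, orWords] at hw <;> rcases hw with rfl | rfl <;> simp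
  · refine ⟨_, List.prefix_append _ _, certified_initial hA q₀, h5, ?_⟩
    rw [h4, Nat.add_zero, h3]
    exact hasStates_append _ _ _ _

theorem Reaches.map {g : Fin m → Fin m} (h0 : σ.reg 0 = 0) (hL : Layered D A₀ st d σ)
    (h : ∀ τ : State, τ.mem = σ.mem → (∀ r, r ≠ 22 → r ≠ 3 → τ.reg r = σ.reg r) →
      Layered D A₀ (fun ν => g (st ν)) d τ → Q τ) :
    Reaches n (HQueries.writeGates (mapWords g) m) Q σ := by
  obtain ⟨A, hp, hA, hout, hS⟩ := hL
  refine .writeGates ?_ (map_wordVal_mapWords h0 g (fun ν => g (st ν)) d) hout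
    fun τ h1 h2 h4 h5 => h τ h1 h2 ?_
  · intro w hw
    obtain ⟨i, -, hw⟩ := List.mem_flatMap.1 hw
    simp only [orWords, List.mem_cons] at hw
    rcases hw with rfl | rfl | hw
    · simp
    · simp
    · exact mem_preimageWords_ne hw
  · refine ⟨_, hp.trans (List.prefix_append _ _), certified_map hA hS g, h5, ?_⟩
    rw [h4, ← hS.length]
    exact hasStates_append _ _ _ _

theorem Reaches.read {δ : Fin m → Fin m} {f : DBFact k} (h0 : σ.reg 0 = 0)
    (hL : Layered D A₀ st d σ) (hf : f ∈ D) (hd : f ∉ d)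
    (f0 : σ.reg 10 = f.rel) (f1 : σ.reg 11 = f.arg₁) (f2 : σ.reg 12 = f.arg₂)
    (h : ∀ τ : State, τ.mem = σ.mem → (∀ r, r ≠ 22 → r ≠ 3 → τ.reg r = σ.reg r) →
      Layered D A₀ (readState δ f st) (insert f d) τ → Q τ) :
    Reaches n (HQueries.writeGates (readWords δ) (3 * m + 2)) Q σ := by
  obtain ⟨A, hp, hA, hout, hS⟩ := hL
  refine .writeGates ?_ (map_wordVal_readWords h0 δ f0 f1 f2 st (readState δ f st) d (insert f d))
    hout fun τ h1 h2 h4 h5 => h τ h1 h2 ?_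
  · intro w hw
    simp only [readWords, andWords, orWords, negWords, List.mem_append, List.mem_flatMap,
      List.mem_cons, List.not_mem_nil, or_false] at hw
    rcases hw with hw | hw | ⟨i, -, hw⟩ | ⟨i, -, hw⟩ | ⟨i, -, hw⟩
    · rcases hw with rfl | rfl | rfl | rfl <;> simp
    · rcases hw with rfl | rfl <;> simp
    · rcases hw with rfl | rfl | rfl | rfl <;> simp
    · rcases hw with rfl | rfl | rfl | rfl <;> simp
    · rcases hw with rfl | rfl | rfl | hw
      · simp
      · simp
      · simp
      · exact mem_preimageWords_ne hw
  · refine ⟨_, hp.trans (List.prefix_append _ _), certified_read hA hS δ hf hd, h5, ?_⟩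
    have hlen : (A ++ readBlock (σ.reg 3) f st d).length = σ.reg 3 + (3 * m + 2) := by
      rw [List.length_append, length_readBlock, hS.length]; omega
    rw [h4, ← hlen, ← List.append_assoc]
    exact hasStates_append _ _ _ _

end LayerPrograms

/-! ### The automaton -/

section Automaton

/-- What the automaton remembers: `inl i` that the `i`-th query of a chain holds, `inr (inl i)` and
`inr (inr i)` that there is a fact with index `i` in the current group and in the current cell. -/
abbrev Feature (k : ℕ) : Type := Fin (k + 2) ⊕ Fin (k + 2) ⊕ Fin (k + 2)

variable {X : Type} {k : ℕ}

/-- The features of a set `Y` of facts, where facts have a group, a cell and an index, and `p` and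
`q` are the current group and cell. -/
def featuresOf (k : ℕ) (grp cell idx : X → ℕ) (p q : ℕ) (Y : Set X) : Feature k → Prop
  | .inl i => ∃ f ∈ Y, ∃ g ∈ Y, idx f = i ∧ idx g = i + 1 ∧ grp f = grp g ∧
      ((i : ℕ) ≠ 0 → cell f = cell g)
  | .inr (.inl i) => ∃ f ∈ Y, idx f = i ∧ grp f = p
  | .inr (.inr i) => ∃ f ∈ Y, idx f = i ∧ grp f = p ∧ cell f = q

/-- The feature that witnesses one half of the `i`-th query. -/
def linkFeature (i j : Fin (k + 2)) : Feature k :=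
  if (i : ℕ) = 0 then .inr (.inl j) else .inr (.inr j)

/-- The features after reading a fact with index `a`. -/
def readFeatures (a : ℕ) (s : Feature k → Prop) : Feature k → Prop
  | .inl i => s (.inl i) ∨ (a = i ∧ ∃ j : Fin (k + 2), (j : ℕ) = i + 1 ∧ s (linkFeature i j)) ∨
      (a = i + 1 ∧ s (linkFeature i i))
  | .inr (.inl i) => s (.inr (.inl i)) ∨ a = i
  | .inr (.inr i) => s (.inr (.inr i)) ∨ a = i

/-- The features after moving to a new cell. -/
def newCell (s : Feature k → Prop) : Feature k → Prop
  | .inr (.inr _) => False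
  | x => s x

/-- The features after moving to a new group. -/
def newGroup (s : Feature k → Prop) : Feature k → Prop
  | .inl i => s (.inl i)
  | .inr _ => False

variable {grp cell idx : X → ℕ} {p q : ℕ} {Y : Set X}

theorem featuresOf_empty : featuresOf k grp cell idx p q ∅ = fun _ => False := by
  funext x
  rcases x with i | i | i <;> simp [featuresOf]

/-- No fact read so far lies in the cell being entered, so clearing the cell features is exact,
whichever cell was current before. -/
theorem featuresOf_newCell (q' : ℕ) (h : ∀ f ∈ Y, grp f = p → cell f ≠ q) :
    newCell (featuresOf k grp cell idx p q' Y) = featuresOf k grp cell idx p q Y := by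
  funext x
  rcases x with i | i | i
  · rfl
  · rfl
  · exact propext ⟨False.elim, fun ⟨f, hf, _, hp, hq⟩ => h f hf hp hq⟩

theorem featuresOf_newGroup (p' q' : ℕ) (h : ∀ f ∈ Y, grp f ≠ p) :
    newGroup (featuresOf k grp cell idx p' q' Y) = featuresOf k grp cell idx p q Y := by
  funext x
  rcases x with i | i | i
  · rfl
  · exact propext ⟨False.elim, fun ⟨f, hf, _, hp⟩ => h f hf hp⟩
  · exact propext ⟨False.elim, fun ⟨f, hf, _, hp, _⟩ => h f hf hp⟩

/-- At the end of a chain the two joined facts share only the group; elsewhere they share the cell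
as well. The choice of feature mirrors this. -/
theorem featuresOf_linkFeature {f : X} (hp : grp f = p) (hq : cell f = q) (i j : Fin (k + 2)) :
    featuresOf k grp cell idx p q Y (linkFeature i j) ↔
      ∃ g ∈ Y, idx g = j ∧ grp f = grp g ∧ ((i : ℕ) ≠ 0 → cell f = cell g) := by
  rw [linkFeature]
  split_ifs with h
  · simp only [h, ne_eq, not_true_eq_false, false_imp_iff, and_true, hp, @eq_comm _ p]; rfl
  · simp only [h, ne_eq, not_false_eq_true, true_imp_iff, hp, hq, @eq_comm _ p, @eq_comm _ q]; rfl

/-- A new witness of a query must use `f`, and its partner lies in the same group, and in the same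
cell where the query requires it. The features of the current group and cell thus hold all the
information the automaton needs. -/
theorem featuresOf_insert (hk : ∀ f, idx f ≤ k + 1) {f : X} (hp : grp f = p) (hq : cell f = q) :
    featuresOf k grp cell idx p q (insert f Y) =
      readFeatures (idx f) (featuresOf k grp cell idx p q Y) := by
  funext x
  apply propext
  rcases x with i | i | i
  · simp only [readFeatures, featuresOf_linkFeature hp hq]
    constructor
    · rintro ⟨g, hg, g', hg', h1, h2, h3, h4⟩
      rcases hg with rfl | hg <;> rcases hg' with rfl | hg'
      -- A fact cannot be its own partner, since the two indices differ by one.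
      · omega
      · have := hk g'
        exact .inr (.inl ⟨h1, ⟨i + 1, by omega⟩, rfl, g', hg', h2, h3, h4⟩)
      · exact .inr (.inr ⟨h2, g, hg, h1, h3.symm, fun h => (h4 h).symm⟩)
      · exact .inl ⟨g, hg, g', hg', h1, h2, h3, h4⟩
    · rintro (⟨g, hg, g', hg', h⟩ | ⟨h1, j, hj, g', hg', h2, h3, h4⟩ | ⟨h2, g, hg, h1, h3, h4⟩)
      · exact ⟨g, .inr hg, g', .inr hg', h⟩
      · exact ⟨f, .inl rfl, g', .inr hg', h1, h2.trans hj, h3, h4⟩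
      · exact ⟨g, .inr hg, f, .inl rfl, h1, h2, h3.symm, fun h => (h4 h).symm⟩
  · constructor
    · rintro ⟨g, rfl | hg, h⟩
      · exact .inr h.1
      · exact .inl ⟨g, hg, h⟩
    · rintro (⟨g, hg, h⟩ | h)
      · exact ⟨g, .inr hg, h⟩
      · exact ⟨f, .inl rfl, h, hp⟩
  · constructor
    · rintro ⟨g, rfl | hg, h⟩
      · exact .inr h.1
      · exact .inl ⟨g, hg, h⟩
    · rintro (⟨g, hg, h⟩ | h)
      · exact ⟨g, .inr hg, h⟩
      · exact ⟨f, .inl rfl, h, hp, hq⟩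

/-- The number of states of the automaton. -/
noncomputable def numStates (k : ℕ) : ℕ := Nat.card (Feature k → Prop)

/-- The numbering of the states of the automaton. -/
noncomputable def stateNum (k : ℕ) : (Feature k → Prop) ≃ Fin (numStates k) := Finite.equivFin _

/-- A map between sets of features as a map between states. -/
noncomputable def onStates (g : (Feature k → Prop) → Feature k → Prop) (i : Fin (numStates k)) :
    Fin (numStates k) := stateNum k (g ((stateNum k).symm i))

end Automaton

/-! ### The program that simulates the automaton -/

section Pass

variable {k : ℕ}

/-- The index of the relation number `r` in the chain of queries from one end or from the other. -/
def relIdx (c r : ℕ) : ℕ := if c = 0 then r else c - r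

theorem relIdx_rel_le {c : ℕ} (hc : c ≤ k + 1) (f : DBFact k) : relIdx c f.rel ≤ k + 1 := by
  have : f.rel ≤ k + 1 := by
    rcases f with a | ⟨i, a, b⟩ | b
    · simp [DBFact.rel]
    · simp [DBFact.rel]; omega
    · simp [DBFact.rel]
  rw [relIdx]; split_ifs <;> omega

/-- Do nothing. -/
def Prog.skip : Prog := .const 22 0

/-- Run `body i`, where `i < b` is the content of `X_10`. -/
def dispatch (body : ℕ → Prog) : ℕ → Prog
  | 0 => .skip
  | i + 1 => .seq (.const 17 i) (.ifEq 10 17 (body i) (dispatch body i))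

/-- Read the fact number `X_8` if it belongs to the current cell. -/
noncomputable def factStep (k c : ℕ) (use : ℕ → Bool) : Prog :=
  .seq (fetch c 8 10) <| .seq (scan c) <| .ifEq 15 6 (.ifEq 16 7 (dispatch (fun r =>
    if use r then writeGates (readWords (onStates (k := k) (readFeatures (relIdx c r))))
      (3 * numStates k + 2) else .skip) (k + 2)) .skip) .skip

/-- Process the current cell. -/
noncomputable def cellStep (k c : ℕ) (use : ℕ → Bool) : Prog :=
  .seq (writeGates (mapWords (onStates (k := k) newCell)) (numStates k)) <|
    .seq (.add 8 1 0) (.countdown 8 (factStep k c use))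

/-- Process the current group. -/
noncomputable def groupStep (k c : ℕ) (use : ℕ → Bool) : Prog :=
  .seq (writeGates (mapWords (onStates (k := k) newGroup)) (numStates k)) <|
    .seq (.add 7 1 0) (.countdown 7 (cellStep k c use))

/-- Let the automaton read all facts whose relations satisfy `use`. -/
noncomputable def pass (k c : ℕ) (use : ℕ → Bool) : Prog :=
  .seq (writeGates (initialWords (stateNum k fun _ => False)) 0) <|
    .seq (.add 6 1 0) (.countdown 6 (groupStep k c use))

variable {n : ℕ} {Q : State → Prop} {σ : State} {L : List (DBFact k)} {c : ℕ} {use : ℕ → Bool}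

theorem Reaches.skip (h : ∀ τ : State, τ.mem = σ.mem → τ.out = σ.out →
    (∀ r, r ≠ 22 → τ.reg r = σ.reg r) → Q τ) : Reaches n .skip Q σ :=
  .const (h _ rfl rfl fun r hr => by simp [Function.update_of_ne hr])

theorem Reaches.dispatch {body : ℕ → Prog} {b : ℕ} (hb : σ.reg 10 < b)
    (h : ∀ τ : State, τ.mem = σ.mem → τ.out = σ.out →
      (∀ r, r ≠ 17 → r ≠ 22 → r ≠ 23 → τ.reg r = σ.reg r) → Reaches n (body (σ.reg 10)) Q τ) :
    Reaches n (dispatch body b) Q σ := by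
  induction b generalizing σ with
  | zero => omega
  | succ b ih =>
    refine .seq (.const (.ifEq (by omega) (by omega) fun τ h1 h2 h3 => ?_))
    have fr : ∀ r, r ≠ 17 → r ≠ 22 → r ≠ 23 → τ.reg r = σ.reg r := fun r a b c => by
      rw [h3 r b c]; simp [Function.update_of_ne a]
    have e10 := fr 10 (by omega) (by omega) (by omega)
    simp only [State.setReg_reg, Function.update_self, ne_eq,       not_false_eq_true, Function.update_of_ne, Nat.reduceEqDiff]
    refine ⟨fun e => e ▸ h τ h1 h2 fr, fun e => ih (by rw [e10]; omega) fun τ' a1 a2 a3 => ?_⟩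
    rw [e10]
    exact h τ' (a1.trans h1) (a2.trans h2) fun r b1 b2 b3 => (a3 r b1 b2 b3).trans (fr r b1 b2 b3)

/-- The facts read before the fact number `i` is considered for the group `p` and the cell `q`. -/
def processed (c : ℕ) (use : ℕ → Bool) (L : List (DBFact k)) (p q i : ℕ) : Set (DBFact k) :=
  {f | f ∈ L ∧ use f.rel = true ∧ (p < majorIdx c L f ∨ (majorIdx c L f = p ∧
    (q < minorIdx c L f ∨ (minorIdx c L f = q ∧ ∃ j, i ≤ j ∧ L[j]? = some f))))}

theorem majorIdx_lt {f : DBFact k} (hf : f ∈ L) : majorIdx c L f < L.length :=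
  List.findIdx_lt_length_of_exists ⟨f, hf, by simp⟩

theorem minorIdx_lt {f : DBFact k} (hf : f ∈ L) : minorIdx c L f < L.length :=
  List.findIdx_lt_length_of_exists ⟨f, hf, by simp⟩

/-- The entry at the first matching position has the argument in question, so position and argument
determine each other. Groups can therefore be enumerated by positions in `L` instead of constants,
whose size is not bounded in terms of the number of facts. -/
theorem majorIdx_eq_iff {f g : DBFact k} (hf : f ∈ L) (hg : g ∈ L) :
    majorIdx c L f = majorIdx c L g ↔ f.major c = g.major c := by
  constructor
  · intro h
    have h1 := List.findIdx_getElem (w := majorIdx_lt (c := c) hf)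
    have h2 := List.findIdx_getElem (w := majorIdx_lt (c := c) hg)
    simp only [decide_eq_true_eq] at h1 h2
    rw [← h1, ← h2]
    congr 2
  · intro h; simp only [majorIdx, h]

theorem minorIdx_eq_iff {f g : DBFact k} (hf : f ∈ L) (hg : g ∈ L) :
    minorIdx c L f = minorIdx c L g ↔ f.minor c = g.minor c := by
  constructor
  · intro h
    have h1 := List.findIdx_getElem (w := minorIdx_lt (c := c) hf)
    have h2 := List.findIdx_getElem (w := minorIdx_lt (c := c) hg)
    simp only [decide_eq_true_eq] at h1 h2
    rw [← h1, ← h2]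
    congr 2
  · intro h; simp only [minorIdx, h]

/-- Loop boundary: finishing cell `q + 1` at position 0 is the same as entering cell `q` with no
position visited. -/
theorem processed_cell (p q : ℕ) :
    processed c use L p (q + 1) 0 = processed c use L p q L.length := by
  ext f
  simp only [processed, Set.mem_ofPred_eq]
  refine and_congr_right fun hf => and_congr_right fun _ => ?_
  have h1 : ∃ j, 0 ≤ j ∧ L[j]? = some f := by
    obtain ⟨j, hj⟩ := List.mem_iff_getElem?.1 hf; exact ⟨j, by omega, hj⟩
  have h2 : ¬ ∃ j, L.length ≤ j ∧ L[j]? = some f := by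
    rintro ⟨j, hj, h⟩; rw [List.getElem?_eq_none hj] at h; simp at h
  simp only [h1, h2, and_true, and_false, or_false]
  omega

theorem processed_group (p : ℕ) :
    processed c use L (p + 1) 0 0 = processed c use L p L.length 0 := by
  ext f
  simp only [processed, Set.mem_ofPred_eq]
  refine and_congr_right fun hf => and_congr_right fun _ => ?_
  have h1 : ∃ j, 0 ≤ j ∧ L[j]? = some f := by
    obtain ⟨j, hj⟩ := List.mem_iff_getElem?.1 hf; exact ⟨j, by omega, hj⟩
  have h2 := minorIdx_lt (c := c) hf
  simp only [h1, and_true]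
  omega

theorem processed_length : processed c use L L.length 0 0 = ∅ := by
  ext f
  simp only [processed, Set.mem_ofPred_eq, Set.mem_empty_iff_false, iff_false]
  rintro ⟨hf, -, h⟩
  have h2 := majorIdx_lt (c := c) hf
  omega

theorem processed_zero : processed c use L 0 0 0 = {f | f ∈ L ∧ use f.rel = true} := by
  ext f
  simp only [processed, Set.mem_ofPred_eq]
  refine and_congr_right fun hf => and_iff_left ?_
  have h1 : ∃ j, 0 ≤ j ∧ L[j]? = some f := by
    obtain ⟨j, hj⟩ := List.mem_iff_getElem?.1 hf; exact ⟨j, by omega, hj⟩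
  simp only [h1, and_true]
  omega

theorem processed_fact {p q i : ℕ} {f : DBFact k} (hf : L[i]? = some f)
    (h : use f.rel = true ∧ majorIdx c L f = p ∧ minorIdx c L f = q) :
    processed c use L p q i = insert f (processed c use L p q (i + 1)) := by
  ext g
  simp only [processed, Set.mem_ofPred_eq, Set.mem_insert_iff]
  constructor
  · rintro ⟨h1, h2, h3 | ⟨h3, h4 | ⟨h4, j, hj, h5⟩⟩⟩
    · exact .inr ⟨h1, h2, .inl h3⟩
    · exact .inr ⟨h1, h2, .inr ⟨h3, .inl h4⟩⟩
    · rcases hj.eq_or_lt with rfl | hj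
      · left; rw [hf] at h5; exact (Option.some.inj h5).symm
      · exact .inr ⟨h1, h2, .inr ⟨h3, .inr ⟨h4, j, hj, h5⟩⟩⟩
  · rintro (rfl | ⟨h1, h2, h3 | ⟨h3, h4 | ⟨h4, j, hj, h5⟩⟩⟩)
    · exact ⟨List.mem_of_getElem? hf, h.1, .inr ⟨h.2.1, .inr ⟨h.2.2, i, le_rfl, hf⟩⟩⟩
    · exact ⟨h1, h2, .inl h3⟩
    · exact ⟨h1, h2, .inr ⟨h3, .inl h4⟩⟩
    · exact ⟨h1, h2, .inr ⟨h3, .inr ⟨h4, j, by omega, h5⟩⟩⟩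

theorem processed_skip {p q i : ℕ} {f : DBFact k} (hf : L[i]? = some f)
    (h : ¬ (use f.rel = true ∧ majorIdx c L f = p ∧ minorIdx c L f = q)) :
    processed c use L p q i = processed c use L p q (i + 1) := by
  ext g
  simp only [processed, Set.mem_ofPred_eq]
  refine and_congr_right fun h1 => and_congr_right fun h2 => or_congr_right <|
    and_congr_right fun h3 => or_congr_right <| and_congr_right fun h4 => ?_
  constructor
  · rintro ⟨j, hj, h5⟩
    rcases hj.eq_or_lt with rfl | hj
    · rw [hf] at h5
      obtain rfl := Option.some.inj h5
      exact absurd ⟨h2, h3, h4⟩ h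
    · exact ⟨j, hj, h5⟩
  · rintro ⟨j, hj, h5⟩
    exact ⟨j, by omega, h5⟩

/-- A fact has a single position, group and cell, so it is read only once. This freshness is what
makes the ∧-gates decomposable, and it rests on `L` having no repetitions. -/
theorem notMem_processed (hL : L.Nodup) {p q i : ℕ} {f : DBFact k} (hf : L[i]? = some f)
    (h : majorIdx c L f = p ∧ minorIdx c L f = q) : f ∉ processed c use L p q (i + 1) := by
  rintro ⟨-, -, h1 | ⟨-, h1 | ⟨-, j, hj, h1⟩⟩⟩
  · omega
  · omega
  · obtain ⟨hi, hi'⟩ := List.getElem?_eq_some_iff.1 hf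
    obtain ⟨hj', hj''⟩ := List.getElem?_eq_some_iff.1 h1
    have := (hL.getElem_inj_iff (hi := hi) (hj := hj')).1 (hi'.trans hj''.symm)
    omega

/-- The state of the automaton on the facts of `Pr`. -/
noncomputable def passState (c : ℕ) (L : List (DBFact k)) (p q : ℕ) (Pr ν : Set (DBFact k)) :
    Fin (numStates k) :=
  stateNum k (featuresOf k (majorIdx c L) (minorIdx c L) (fun f => relIdx c f.rel) p q (Pr ∩ ν))

/-- Memory and registers outside of the working area of a pass are unchanged. -/
def Outside (σ τ : State) : Prop :=
  τ.mem = σ.mem ∧ ∀ r, r ≠ 3 → (r < 6 ∨ 23 < r) → τ.reg r = σ.reg r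

variable {A₀ : List (AnnotatedGate (DBFact k))}

theorem Outside.env {τ : State} (h : Outside σ τ) (hσ : Env L σ) : Env L τ :=
  hσ.congr h.1 fun r hr => h.2 r (by omega) (by omega)

/-- If `f` is present, the transition is `featuresOf_insert`; if it is absent, neither the state nor
the visible part of the processed set changes. -/
theorem readState_passState (hc : c ≤ k + 1) {p q : ℕ} {f : DBFact k} {Pr : Set (DBFact k)}
    (h : majorIdx c L f = p ∧ minorIdx c L f = q) :
    readState (onStates (readFeatures (relIdx c f.rel))) f (passState c L p q Pr) =
      passState c L p q (insert f Pr) := by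
  funext ν
  by_cases hν : f ∈ ν
  · have e : insert f Pr ∩ ν = insert f (Pr ∩ ν) := by
      ext g; simp only [Set.mem_inter_iff, Set.mem_insert_iff]
      constructor
      · rintro ⟨rfl | h1, h2⟩ <;> tauto
      · rintro (rfl | h1) <;> tauto
    simp only [readState, hν, if_true, passState, onStates, Equiv.symm_apply_apply, e]
    rw [featuresOf_insert (idx := fun f : DBFact k => relIdx c f.rel) (relIdx_rel_le hc) h.1 h.2]
  · have e : insert f Pr ∩ ν = Pr ∩ ν := by
      ext g; simp only [Set.mem_inter_iff, Set.mem_insert_iff]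
      constructor
      · rintro ⟨rfl | h1, h2⟩ <;> tauto
      · tauto
    simp only [readState, hν, if_false, passState, e]

theorem Reaches.factStep (hc : c ≤ k + 1) (hL : L.Nodup) {σ₀ : State} (h₀ : Env L σ₀)
    {p q i : ℕ} {f : DBFact k} (hf : L[i]? = some f) (ho : Outside σ₀ σ) (h6 : σ.reg 6 = p)
    (h7 : σ.reg 7 = q) (h8 : σ.reg 8 = i)
    (hl : Layered {f | f ∈ L} A₀ (passState c L p q (processed c use L p q (i + 1)))
      (processed c use L p q (i + 1)) σ)
    (h : ∀ τ, Outside σ₀ τ → τ.reg 6 = p → τ.reg 7 = q → τ.reg 8 = i →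
      Layered {f | f ∈ L} A₀ (passState c L p q (processed c use L p q i))
        (processed c use L p q i) τ → Q τ) :
    Reaches L.length (factStep k c use) Q σ := by
  refine .seq (.fetch (ho.env h₀) (by omega) (by omega) (by omega) (h8 ▸ hf)
    fun τ₁ a1 a2 a3 a4 a5 a6 a7 a8 => .seq (.scan ((ho.env h₀).congr a1 fun r hr =>
      a3 r (by omega) (by omega)) a7 a8 fun τ₂ b1 b2 b3 b4 b5 =>
      .ifEq (by omega) (by omega) fun τ₃ c1 c2 c3 => ?_))
  -- A wrong group, a wrong cell and an unused relation all end in the same way: nothing is written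
  -- and the processed set stays the same.
  have done : ∀ τ : State, τ.mem = σ.mem → τ.out = σ.out →
      (∀ r, (r < 9 ∨ 23 < r) → τ.reg r = σ.reg r) →
      ¬ (use f.rel = true ∧ majorIdx c L f = p ∧ minorIdx c L f = q) → Q τ := by
    intro τ d1 d2 d3 d4
    refine h τ ⟨d1.trans ho.1, fun r hr hr' => (d3 r (by omega)).trans (ho.2 r hr hr')⟩
      ((d3 6 (by omega)).trans h6) ((d3 7 (by omega)).trans h7) ((d3 8 (by omega)).trans h8) ?_
    rw [processed_skip hf d4]
    exact hl.congr d2 (d3 3 (by omega))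
  have f2 : ∀ r, (r < 9 ∨ 23 < r) → τ₂.reg r = σ.reg r := fun r hr => by
    rw [b3 r (by omega) (by omega), a3 r (by omega) (by omega)]
  have f3 : ∀ r, (r < 9 ∨ 23 < r) → τ₃.reg r = σ.reg r := fun r hr => by
    rw [c3 r (by omega) (by omega), f2 r hr]
  have m3 : τ₃.mem = σ.mem := c1.trans (b1.trans a1)
  have o3 : τ₃.out = σ.out := c2.trans (b2.trans a2)
  rw [b4, f2 6 (by omega), h6]
  refine ⟨fun e6 => .ifEq (by omega) (by omega) fun τ₄ d1 d2 d3 => ?_, fun e6 => .skip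
    fun τ e1 e2 e3 => done τ (e1.trans m3) (e2.trans o3)
      (fun r hr => (e3 r (by omega)).trans (f3 r hr)) (fun hh => e6 hh.2.1)⟩
  have f4 : ∀ r, (r < 9 ∨ 23 < r) → τ₄.reg r = σ.reg r := fun r hr => by
    rw [d3 r (by omega) (by omega), f3 r hr]
  have m4 : τ₄.mem = σ.mem := d1.trans m3
  have o4 : τ₄.out = σ.out := d2.trans o3
  rw [c3 16 (by omega) (by omega), b5, f3 7 (by omega), h7]
  refine ⟨fun e7 => ?_, fun e7 => .skip fun τ e1 e2 e3 => done τ (e1.trans m4) (e2.trans o4)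
      (fun r hr => (e3 r (by omega)).trans (f4 r hr)) (fun hh => e7 hh.2.2)⟩
  have g4 : ∀ r, 10 ≤ r → r ≤ 12 → τ₄.reg r = τ₁.reg r := fun r h1 h2 => by
    rw [d3 r (by omega) (by omega), c3 r (by omega) (by omega), b3 r (by omega) (by omega)]
  have hrel : τ₄.reg 10 = f.rel := by rw [g4 10 (by omega) (by omega), a4]
  have hlt : f.rel < k + 2 := by
    have := relIdx_rel_le (c := 0) (by omega) f
    simp only [relIdx, if_true] at this
    omega
  refine .dispatch (by rw [hrel]; exact hlt) fun τ₅ e1 e2 e3 => ?_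
  have f5 : ∀ r, (r < 9 ∨ 23 < r) → τ₅.reg r = σ.reg r := fun r hr => by
    rw [e3 r (by omega) (by omega) (by omega), f4 r hr]
  have m5 : τ₅.mem = σ.mem := e1.trans m4
  have o5 : τ₅.out = σ.out := e2.trans o4
  rw [hrel]
  by_cases hu : use f.rel = true
  · rw [if_pos hu]
    refine .read (((ho.env h₀).congr m5 fun r hr => f5 r (by omega)).zero)
      (hl.congr o5 (f5 3 (by omega))) (List.mem_of_getElem? hf)
      (notMem_processed hL hf ⟨e6, e7⟩) ?_ ?_ ?_ ?_
    · rw [e3 10 (by omega) (by omega) (by omega), hrel]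
    · rw [e3 11 (by omega) (by omega) (by omega), g4 11 (by omega) (by omega), a5]
    · rw [e3 12 (by omega) (by omega) (by omega), g4 12 (by omega) (by omega), a6]
    intro τ i1 i2 i3
    refine h τ ⟨(i1.trans m5).trans ho.1, fun r hr hr' =>
      ((i2 r (by omega) hr).trans (f5 r (by omega))).trans (ho.2 r hr hr')⟩
      (by rw [i2 6 (by omega) (by omega), f5 6 (by omega), h6])
      (by rw [i2 7 (by omega) (by omega), f5 7 (by omega), h7])
      (by rw [i2 8 (by omega) (by omega), f5 8 (by omega), h8]) ?_
    rw [processed_fact hf ⟨hu, e6, e7⟩, ← readState_passState hc ⟨e6, e7⟩]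
    exact i3
  · rw [if_neg hu]
    exact .skip fun τ i1 i2 i3 => done τ (i1.trans m5) (i2.trans o5)
      (fun r hr => (i3 r (by omega)).trans (f5 r hr)) (fun hh => hu hh.1)

theorem exists_getElem?_eq_some {i : ℕ} (h : i < L.length) : ∃ f, L[i]? = some f :=
  ⟨_, List.getElem?_eq_getElem h⟩

theorem Reaches.cellStep (hc : c ≤ k + 1) (hL : L.Nodup) {σ₀ : State} (h₀ : Env L σ₀)
    {p q : ℕ} (ho : Outside σ₀ σ) (h6 : σ.reg 6 = p) (h7 : σ.reg 7 = q)
    (hl : Layered {f | f ∈ L} A₀ (passState c L p (q + 1) (processed c use L p (q + 1) 0))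
      (processed c use L p (q + 1) 0) σ)
    (h : ∀ τ, Outside σ₀ τ → τ.reg 6 = p → τ.reg 7 = q →
      Layered {f | f ∈ L} A₀ (passState c L p q (processed c use L p q 0))
        (processed c use L p q 0) τ → Q τ) :
    Reaches L.length (cellStep k c use) Q σ := by
  refine .seq (.map (ho.env h₀).zero hl fun τ₁ a1 a2 a3 => .seq (.add ?_))
  have o1 : Outside σ₀ τ₁ := ⟨a1.trans ho.1, fun r hr hr' => (a2 r (by omega) hr).trans
    (ho.2 r hr hr')⟩
  refine Reaches.mono (Reaches.loop (fun i τ => Outside σ₀ τ ∧ τ.reg 6 = p ∧ τ.reg 7 = q ∧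
    τ.reg 8 = i ∧ Layered {f | f ∈ L} A₀ (passState c L p q (processed c use L p q i))
        (processed c use L p q i) τ) (fun i τ hτ => hτ.2.2.2.1) ?_ ?_) ?_
  · rintro i hi τ ⟨b1, b2, b3, b4, b5⟩
    obtain ⟨f, hf⟩ := exists_getElem?_eq_some hi
    refine .seq (.sub (.factStep hc hL h₀ hf ⟨b1.1, fun r hr hr' => ?_⟩ (by simpa using b2)
      (by simpa using b3) (by simp [b4, (b1.env h₀).one]) (b5.congr rfl (by simp))
      fun τ c1 c2 c3 c4 c5 => ⟨c1, c2, c3, c4, c5⟩))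
    rw [← b1.2 r hr hr']
    simp [show r ≠ 8 by omega]
  · refine ⟨⟨o1.1, fun r hr hr' => ?_⟩, ?_, ?_, ?_, ?_⟩
    · rw [← o1.2 r hr hr']; simp [show r ≠ 8 by omega]
    · simp [a2, h6]
    · simp [a2, h7]
    · simp [(o1.env h₀).len, (o1.env h₀).zero]
    · refine Layered.congr (σ := τ₁) ?_ rfl (by simp)
      rw [← processed_cell]
      have : (fun ν => onStates newCell (passState c L p (q + 1)
          (processed c use L p (q + 1) 0) ν)) =
          passState c L p q (processed c use L p (q + 1) 0) := by
        funext ν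
        simp only [onStates, passState, Equiv.symm_apply_apply]
        rw [featuresOf_newCell]
        -- Cells are visited in decreasing order, so within group `p` only cells above `q` have been
        -- processed.
        rintro f ⟨⟨-, -, hf⟩, -⟩ hp hq
        omega
      rwa [this] at a3
  · rintro τ ⟨b1, b2, b3, -, b5⟩
    exact h τ b1 b2 b3 b5

theorem Reaches.groupStep (hc : c ≤ k + 1) (hL : L.Nodup) {σ₀ : State} (h₀ : Env L σ₀)
    {p : ℕ} (ho : Outside σ₀ σ) (h6 : σ.reg 6 = p)
    (hl : Layered {f | f ∈ L} A₀ (passState c L (p + 1) 0 (processed c use L (p + 1) 0 0))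
      (processed c use L (p + 1) 0 0) σ)
    (h : ∀ τ, Outside σ₀ τ → τ.reg 6 = p →
      Layered {f | f ∈ L} A₀ (passState c L p 0 (processed c use L p 0 0))
        (processed c use L p 0 0) τ → Q τ) :
    Reaches L.length (groupStep k c use) Q σ := by
  refine .seq (.map (ho.env h₀).zero hl fun τ₁ a1 a2 a3 => .seq (.add ?_))
  have o1 : Outside σ₀ τ₁ := ⟨a1.trans ho.1, fun r hr hr' => (a2 r (by omega) hr).trans
    (ho.2 r hr hr')⟩
  refine Reaches.mono (Reaches.loop (fun q τ => Outside σ₀ τ ∧ τ.reg 6 = p ∧ τ.reg 7 = q ∧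
    Layered {f | f ∈ L} A₀ (passState c L p q (processed c use L p q 0))
        (processed c use L p q 0) τ) (fun i τ hτ => hτ.2.2.1) ?_ ?_) ?_
  · rintro q hq τ ⟨b1, b2, b3, b5⟩
    refine .seq (.sub (.cellStep hc hL h₀ ⟨b1.1, fun r hr hr' => ?_⟩ (by simpa using b2)
      (by simp [b3, (b1.env h₀).one]) (b5.congr rfl (by simp))
      fun τ c1 c2 c3 c5 => ⟨c1, c2, c3, c5⟩))
    rw [← b1.2 r hr hr']
    simp [show r ≠ 7 by omega]
  · refine ⟨⟨o1.1, fun r hr hr' => ?_⟩, ?_, ?_, ?_⟩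
    · rw [← o1.2 r hr hr']; simp [show r ≠ 7 by omega]
    · simp [a2, h6]
    · simp [(o1.env h₀).len, (o1.env h₀).zero]
    · refine Layered.congr (σ := τ₁) ?_ rfl (by simp)
      rw [← processed_group]
      have : (fun ν => onStates newGroup (passState c L (p + 1) 0
          (processed c use L (p + 1) 0 0) ν)) =
          passState c L p L.length (processed c use L (p + 1) 0 0) := by
        funext ν
        simp only [onStates, passState, Equiv.symm_apply_apply]
        rw [featuresOf_newGroup]
        -- Groups are visited in decreasing order, so every processed fact has a group above `p`.
        rintro f ⟨⟨-, -, hf⟩, -⟩ hp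
        omega
      rwa [this] at a3
  · rintro τ ⟨b1, b2, -, b5⟩
    exact h τ b1 b2 b5

theorem Reaches.pass (hc : c ≤ k + 1) (hL : L.Nodup) (hσ : Env L σ)
    (hA : Certified {f | f ∈ L} A₀) (hout : σ.out = gatesCode A₀) (h3 : σ.reg 3 = A₀.length)
    (h : ∀ τ, Outside σ τ → Layered {f | f ∈ L} A₀
      (passState c L 0 0 {f | f ∈ L ∧ use f.rel = true}) {f | f ∈ L ∧ use f.rel = true} τ → Q τ) :
    Reaches L.length (pass k c use) Q σ := by
  refine .seq (.initial hσ.zero hA hout h3 fun τ₁ a1 a2 a3 => .seq (.add ?_))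
  have o1 : Outside σ τ₁ := ⟨a1, fun r hr hr' => a2 r (by omega) hr⟩
  refine Reaches.mono (Reaches.loop (fun p τ => Outside σ τ ∧ τ.reg 6 = p ∧
    Layered {f | f ∈ L} A₀ (passState c L p 0 (processed c use L p 0 0))
        (processed c use L p 0 0) τ) (fun i τ hτ => hτ.2.1) ?_ ?_) ?_
  · rintro p hp τ ⟨b1, b2, b5⟩
    refine .seq (.sub (.groupStep hc hL hσ ⟨b1.1, fun r hr hr' => ?_⟩
      (by simp [b2, (b1.env hσ).one]) (b5.congr rfl (by simp))
      fun τ c1 c2 c5 => ⟨c1, c2, c5⟩))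
    rw [← b1.2 r hr hr']
    simp [show r ≠ 6 by omega]
  · refine ⟨⟨o1.1, fun r hr hr' => ?_⟩, ?_, ?_⟩
    · rw [← o1.2 r hr hr']; simp [show r ≠ 6 by omega]
    · simp [(o1.env hσ).len, (o1.env hσ).zero]
    · refine Layered.congr (σ := τ₁) ?_ rfl (by simp)
      rw [processed_length]
      have : passState (k := k) c L L.length 0 ∅ = fun _ => stateNum k fun _ => False := by
        funext ν
        simp only [passState, Set.empty_inter, featuresOf_empty]
      rwa [this]
  · rintro τ ⟨b1, -, b5⟩
    rw [processed_zero] at b5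
    exact h τ b1 b5

end Pass

/-! ### The queries in terms of features -/

section Semantics

variable {k : ℕ}

theorem R_mem_iff {Y : Set (DBFact k)} {a : ℕ} :
    DBFact.R a ∈ Y ↔ ∃ f ∈ Y, f.rel = 0 ∧ f.arg₁ = a := by
  constructor
  · intro h; exact ⟨_, h, rfl, rfl⟩
  · rintro ⟨b | ⟨i, b, c⟩ | b, h, h1, rfl⟩
    · exact h
    · simp [DBFact.rel] at h1; omega
    · simp [DBFact.rel] at h1

theorem T_mem_iff {Y : Set (DBFact k)} {a : ℕ} :
    DBFact.T a ∈ Y ↔ ∃ f ∈ Y, f.rel = k + 1 ∧ f.arg₁ = a := by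
  constructor
  · intro h; exact ⟨_, h, rfl, rfl⟩
  · rintro ⟨b | ⟨i, b, c⟩ | b, h, h1, rfl⟩
    · simp [DBFact.rel] at h1
    · simp [DBFact.rel] at h1; omega
    · exact h

theorem holdsS_iff {Y : Set (DBFact k)} {i a b : ℕ} (h1 : 1 ≤ i) (hk : i ≤ k) :
    holdsS Y i a b ↔ ∃ f ∈ Y, f.rel = i ∧ f.arg₁ = a ∧ f.arg₂ = b := by
  constructor
  · rintro ⟨h, hf⟩; exact ⟨_, hf, rfl, rfl, rfl⟩
  · rintro ⟨b | ⟨⟨i, hi⟩, b, c⟩ | b, h, rfl, rfl, rfl⟩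
    · simp [DBFact.rel] at h1
    · exact ⟨hi, h⟩
    · simp [DBFact.rel] at hk

theorem hQuery_zero_iff (hk : 1 ≤ k) {Y : Set (DBFact k)} {i : Fin (k + 1)} (hi : (i : ℕ) = 0) :
    hQuery k i Y ↔ ∃ f ∈ Y, ∃ g ∈ Y, f.rel = 0 ∧ g.rel = 1 ∧ f.arg₁ = g.arg₁ := by
  rw [hQuery, if_pos hi]
  simp only [R_mem_iff, holdsS_iff le_rfl hk]
  constructor
  · rintro ⟨x, y, ⟨f, hf, h1, h2⟩, g, hg, h3, h4, h5⟩
    exact ⟨f, hf, g, hg, h1, h3, h2.trans h4.symm⟩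
  · rintro ⟨f, hf, g, hg, h1, h2, h3⟩
    exact ⟨_, _, ⟨f, hf, h1, h3⟩, g, hg, h2, rfl, rfl⟩

theorem hQuery_mid_iff {Y : Set (DBFact k)} {i : Fin (k + 1)} (hi : (i : ℕ) ≠ 0)
    (hik : (i : ℕ) < k) : hQuery k i Y ↔ ∃ f ∈ Y, ∃ g ∈ Y, f.rel = i ∧ g.rel = i + 1 ∧
      f.arg₁ = g.arg₁ ∧ f.arg₂ = g.arg₂ := by
  rw [hQuery, if_neg hi, if_pos hik]
  simp only [holdsS_iff (Y := Y) (i := i) (by omega) hik.le,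
    holdsS_iff (Y := Y) (i := (i : ℕ) + 1) (by omega) hik]
  constructor
  · rintro ⟨x, y, ⟨f, hf, h1, h2, h2'⟩, g, hg, h3, h4, h5⟩
    exact ⟨f, hf, g, hg, h1, h3, h2.trans h4.symm, h2'.trans h5.symm⟩
  · rintro ⟨f, hf, g, hg, h1, h2, h3, h4⟩
    exact ⟨_, _, ⟨f, hf, h1, h3, h4⟩, g, hg, h2, rfl, rfl⟩

theorem hQuery_last_iff (hk : 1 ≤ k) {Y : Set (DBFact k)} {i : Fin (k + 1)} (hi : (i : ℕ) = k) :
    hQuery k i Y ↔ ∃ f ∈ Y, ∃ g ∈ Y, f.rel = k + 1 ∧ g.rel = k ∧ f.arg₁ = g.arg₂ := by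
  rw [hQuery, if_neg (by omega), if_neg (by omega)]
  simp only [T_mem_iff, holdsS_iff hk le_rfl]
  constructor
  · rintro ⟨x, y, ⟨g, hg, h3, h4, h5⟩, f, hf, h1, h2⟩
    exact ⟨f, hf, g, hg, h1, h3, h2.trans h5.symm⟩
  · rintro ⟨f, hf, g, hg, h1, h2, h3⟩
    exact ⟨_, _, ⟨g, hg, h2, rfl, rfl⟩, f, hf, h1, h3⟩

variable {L : List (DBFact k)}

/-- The features found by a pass. -/
def passFeatures (c : ℕ) (use : ℕ → Bool) (L : List (DBFact k)) (ν : Set (DBFact k)) :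
    Feature k → Prop :=
  featuresOf k (majorIdx c L) (minorIdx c L) (fun f => relIdx c f.rel) 0 0
    ({f | f ∈ L ∧ use f.rel = true} ∩ ν)

theorem passFeatures_inl_iff {c : ℕ} {use : ℕ → Bool} {ν : Set (DBFact k)} {j : Fin (k + 2)} :
    passFeatures c use L ν (.inl j) ↔ ∃ f ∈ {f | f ∈ L} ∩ ν, ∃ g ∈ {f | f ∈ L} ∩ ν,
      (use f.rel = true ∧ use g.rel = true) ∧ relIdx c f.rel = j ∧ relIdx c g.rel = j + 1 ∧
        f.major c = g.major c ∧ ((j : ℕ) ≠ 0 → f.minor c = g.minor c) := by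
  constructor
  · rintro ⟨f, ⟨⟨hf, uf⟩, nf⟩, g, ⟨⟨hg, ug⟩, ng⟩, h1, h2, h3, h4⟩
    rw [majorIdx_eq_iff hf hg] at h3
    rw [minorIdx_eq_iff hf hg] at h4
    exact ⟨f, ⟨hf, nf⟩, g, ⟨hg, ng⟩, ⟨uf, ug⟩, h1, h2, h3, h4⟩
  · rintro ⟨f, ⟨hf, nf⟩, g, ⟨hg, ng⟩, ⟨uf, ug⟩, h1, h2, h3, h4⟩
    rw [← majorIdx_eq_iff hf hg] at h3
    rw [← minorIdx_eq_iff hf hg] at h4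
    exact ⟨f, ⟨⟨hf, uf⟩, nf⟩, g, ⟨⟨hg, ug⟩, ng⟩, h1, h2, h3, h4⟩

/-- With `c = 0` facts are grouped by their first argument and indexed by their relation number. A
query with index below `l` uses relations numbered at most `l`, so the filter discards none of its
witnesses. -/
theorem passFeatures_left (hk : 1 ≤ k) {l : ℕ} (hl : l ≤ k) {ν : Set (DBFact k)} {i : Fin (k + 1)}
    {j : Fin (k + 2)} (hij : (j : ℕ) = i) (hj : (j : ℕ) < l) :
    passFeatures 0 (fun r => decide (r ≤ l)) L ν (.inl j) ↔ hQuery k i ({f | f ∈ L} ∩ ν) := by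
  rw [passFeatures_inl_iff]
  simp only [relIdx, if_true, DBFact.major, DBFact.minor, Nat.zero_sub, ne_eq, not_true_eq_false,
    if_false, decide_eq_true_eq]
  by_cases h0 : (i : ℕ) = 0
  · rw [hQuery_zero_iff hk h0]
    refine exists_congr fun f => and_congr_right fun hf => exists_congr fun g =>
      and_congr_right fun hg => ?_
    constructor
    · rintro ⟨-, h1, h2, h3, -⟩; exact ⟨by omega, by omega, h3⟩
    · rintro ⟨h1, h2, h3⟩; exact ⟨by omega, by omega, by omega, h3, fun h => absurd hij (by omega)⟩
  · rw [hQuery_mid_iff h0 (by omega)]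
    refine exists_congr fun f => and_congr_right fun hf => exists_congr fun g =>
      and_congr_right fun hg => ?_
    constructor
    · rintro ⟨-, h1, h2, h3, h4⟩; exact ⟨by omega, by omega, h3, h4 (by omega)⟩
    · rintro ⟨h1, h2, h3, h4⟩; exact ⟨by omega, by omega, by omega, h3, fun _ => h4⟩

/-- With `c = k + 1` the chain is read from the other end: `T` has index 0 and `S_k` index 1, and
facts are grouped by `y`, which is the second argument of `S_i` and the only one of `T`. Thus
feature `j` belongs to the query `k - j`. -/
theorem passFeatures_right (hk : 1 ≤ k) {l : ℕ} {ν : Set (DBFact k)} {i : Fin (k + 1)}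
    {j : Fin (k + 2)} (hij : (i : ℕ) + j = k) (hj : l < i) :
    passFeatures (k + 1) (fun r => decide (l < r)) L ν (.inl j) ↔
      hQuery k i ({f | f ∈ L} ∩ ν) := by
  rw [passFeatures_inl_iff]
  simp only [relIdx, Nat.add_eq_zero_iff, one_ne_zero, and_false, DBFact.major, DBFact.minor, ne_eq,
    if_false, decide_eq_true_eq]
  by_cases h0 : (j : ℕ) = 0
  · rw [hQuery_last_iff hk (by omega)]
    refine exists_congr fun f => and_congr_right fun hf => exists_congr fun g =>
      and_congr_right fun hg => ?_
    have hf' := relIdx_rel_le (c := 0) (by omega) f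
    simp only [relIdx, if_true] at hf'
    constructor
    · rintro ⟨-, h1, h2, h3, -⟩
      rw [if_neg (by omega), if_pos (by omega)] at h3
      exact ⟨by omega, by omega, h3⟩
    · rintro ⟨h1, h2, h3⟩
      rw [if_neg (by omega), if_pos (by omega)]
      exact ⟨by omega, by omega, by omega, h3, fun h => absurd h0 h⟩
  · rw [hQuery_mid_iff (by omega) (by omega)]
    constructor
    · rintro ⟨f, hf, g, hg, -, h1, h2, h3, h4⟩
      have h4 := h4 (by omega)
      rw [if_pos (by omega), if_pos (by omega)] at h3 h4
      -- Reversing the chain exchanges the roles of the two facts and of the two arguments.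
      exact ⟨g, hg, f, hf, by omega, by omega, h4.symm, h3.symm⟩
    · rintro ⟨g, hg, f, hf, h1, h2, h3, h4⟩
      refine ⟨f, hf, g, hg, by omega, by omega, by omega, ?_⟩
      rw [if_pos (by omega), if_pos (by omega), if_pos (by omega), if_pos (by omega)]
      exact ⟨h4.symm, fun _ => h3.symm⟩

open Classical in
/-- The set of the queries `h_{k,i}` that hold in `Y`. -/
noncomputable def heldQueries (Y : Set (DBFact k)) : Finset (Fin (k + 1)) :=
  Finset.univ.filter fun i => hQuery k i Y

theorem mem_heldQueries {Y : Set (DBFact k)} {i : Fin (k + 1)} :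
    i ∈ heldQueries Y ↔ hQuery k i Y := by
  simp [heldQueries]

/-- The first `b` queries of a chain hold exactly as prescribed. -/
def MatchesPattern (b : ℕ) (pat : ℕ → Prop) (s : Feature k → Prop) : Prop :=
  ∀ j : Fin (k + 2), (j : ℕ) < b → (s (.inl j) ↔ pat j)

/-- Being one of `N` and `insert l N` means agreeing with `N` on every query except `l`. That query
is the only one joining relation `l` with relation `l + 1`, so ignoring it splits the remaining ones
into two chains over disjoint relations. -/
theorem matchesPattern_iff (hk : 1 ≤ k) (l : Fin (k + 1)) (N : Finset (Fin (k + 1)))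
    (hl : l ∉ N) (ν : Set (DBFact k)) :
    (MatchesPattern l (fun j => ∃ i ∈ N, (i : ℕ) = j)
        (passFeatures 0 (fun r => decide (r ≤ (l : ℕ))) L ν) ∧
      MatchesPattern (k - l) (fun j => ∃ i ∈ N, (i : ℕ) + j = k)
        (passFeatures (k + 1) (fun r => decide ((l : ℕ) < r)) L ν)) ↔
      heldQueries ({f | f ∈ L} ∩ ν) ∈ ({N, insert l N} : Finset (Finset (Fin (k + 1)))) := by
  have key : heldQueries ({f | f ∈ L} ∩ ν) ∈ ({N, insert l N} : Finset (Finset (Fin (k + 1)))) ↔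
      ∀ i, i ≠ l → (hQuery k i ({f | f ∈ L} ∩ ν) ↔ i ∈ N) := by
    simp only [← mem_heldQueries]
    generalize heldQueries ({f | f ∈ L} ∩ ν) = M
    rw [Finset.mem_insert, Finset.mem_singleton]
    constructor
    · rintro (rfl | rfl) i hi <;> simp [hi]
    · intro h
      by_cases hM : l ∈ M
      · right; ext i; by_cases hi : i = l
        · subst hi; simp [hM]
        · simp [hi, h i hi]
      · left; ext i; by_cases hi : i = l
        · subst hi; simp [hM, hl]
        · simp [h i hi]
  rw [key]
  have hlk : (l : ℕ) ≤ k := by omega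
  constructor
  · rintro ⟨h1, h2⟩ i hi
    have hne : (i : ℕ) ≠ l := fun e => hi (Fin.ext e)
    rcases lt_or_gt_of_ne hne with h | h
    · rw [← passFeatures_left hk hlk (j := i.castSucc) rfl h, h1 i.castSucc h]
      exact ⟨fun ⟨i', hi', e⟩ => Fin.ext (a := i') (b := i) e ▸ hi', fun h => ⟨i, h, rfl⟩⟩
    · have hj : (⟨k - i, by omega⟩ : Fin (k + 2)).val < k - l := by simp only; omega
      rw [← passFeatures_right hk (j := ⟨k - i, by omega⟩) (by simp only; omega) h, h2 _ hj]
      refine ⟨fun ⟨i', hi', e⟩ => ?_, fun h => ⟨i, h, by simp only; omega⟩⟩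
      simp only at e
      exact Fin.ext (a := i') (b := i) (by omega) ▸ hi'
  · intro h
    refine ⟨fun j hj => ?_, fun j hj => ?_⟩
    · rw [passFeatures_left hk hlk (i := ⟨j, by omega⟩) rfl hj,
        h _ (fun e => by have := congrArg Fin.val e; simp only at this; omega)]
      exact ⟨fun h => ⟨_, h, rfl⟩, fun ⟨i', hi', e⟩ =>
        Fin.ext (a := i') (b := ⟨j, by omega⟩) e ▸ hi'⟩
    · rw [passFeatures_right hk (i := ⟨k - j, by omega⟩) (by simp only; omega)
        (by simp only; omega),
        h _ (fun e => by have := congrArg Fin.val e; simp only at this; omega)]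
      refine ⟨fun h => ⟨_, h, by simp only; omega⟩, fun ⟨i', hi', e⟩ => ?_⟩
      exact Fin.ext (a := i') (b := ⟨k - j, by omega⟩) (by simp only; omega) ▸ hi'

end Semantics

/-! ### The program -/

section Program

variable {k m n : ℕ} {Q : State → Prop} {σ : State} {L : List (DBFact k)}

/-- Write a single gate, at position `X_3 + c`, and store its position in `X_r`. -/
def writeGate (l : List (ℕ × ℕ)) (c r : ℕ) : Prog :=
  .seq (writeGates l c) (.seq (.add r 3 0) (.add 3 3 2))

/-- The output encodes the certified circuit `A` and `X_3` is its size. -/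
structure Written (L : List (DBFact k)) (A : List (AnnotatedGate (DBFact k))) (σ : State) :
    Prop where
  env : Env L σ
  certified : Certified {f | f ∈ L} A
  out : σ.out = gatesCode A
  size : σ.reg 3 = A.length

/-- The offset `c` bridges two conventions: after a pass `X_3` is the start of the last state layer,
while `Written` takes it to be the size of the circuit. -/
theorem Reaches.writeGate {l : List (ℕ × ℕ)} {c r : ℕ} {A : List (AnnotatedGate (DBFact k))}
    (e : AnnotatedGate (DBFact k)) (hl : ∀ w ∈ l, w.1 ≠ 22)
    (hl' : l.map (wordVal σ.reg) = e.gate.code) (hσ : Env L σ) (hA : Certified {f | f ∈ L} A)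
    (he : GateOK {f | f ∈ L} A e) (hout : σ.out = gatesCode A) (hc : σ.reg 3 + c = A.length)
    (hr : 3 < r)
    (h : ∀ τ : State, Written L (A ++ [e]) τ → τ.reg r = A.length →
      (∀ s, s ≠ 3 → s ≠ 22 → s ≠ r → τ.reg s = σ.reg s) → Q τ) :
    Reaches n (writeGate l c r) Q σ := by
  refine .seq (.writeGates hl (B := [e]) (by simp [gatesCode, hl']) hout fun τ h1 h2 h3 h4 =>
    .seq (.add (.add ?_)))
  have e0 : τ.reg 0 = 0 := by rw [h2 0 (by omega) (by omega), hσ.zero]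
  have e2 : τ.reg 2 = 1 := by rw [h2 2 (by omega) (by omega), hσ.one]
  have fr : ∀ s, s ≠ 3 → s ≠ 22 → s ≠ r → ((τ.setReg r (τ.reg 3 + τ.reg 0)).setReg 3
      ((τ.setReg r (τ.reg 3 + τ.reg 0)).reg 3 + (τ.setReg r (τ.reg 3 + τ.reg 0)).reg 2)).reg s =
        σ.reg s := by
    intro s s1 s2 s3
    simp [Function.update_of_ne, s1, s3, h2 s s2 s1]
  refine h _ ⟨hσ.congr h1 fun s hs => fr s (by omega) (by omega) (by omega), hA.snoc he, ?_, ?_⟩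
    ?_ fr
  · simpa using h4
  · have r3 : 3 ≠ r := by omega
    have r2 : 2 ≠ r := by omega
    simp [Function.update_of_ne r3, Function.update_of_ne r2, h3, e2, hc]
  · have r3 : r ≠ 3 := by omega
    simp [Function.update_of_ne r3, h3, e0, hc]

/-- The gate for the disjunction of the states satisfying `acc`. -/
theorem gateOK_select {X : Type} {D : Set X} {A : List (AnnotatedGate X)} {S : ℕ}
    {st : Set X → Fin m} {d : Set X} (hS : HasStates A S st d) (acc : Fin m → Bool) :
    GateOK D A ⟨.or (preimage acc S true), fun ν => acc (st ν) = true, d⟩ := by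
  refine ⟨fun a ha => ?_, nodup_preimage acc S true, fun a ha => ?_, fun a ha b hb hab ν => ?_,
    fun ν => ?_⟩
  · obtain ⟨j, -, rfl⟩ := mem_preimage.1 ha
    rw [hS.length]; omega
  · obtain ⟨j, -, rfl⟩ := mem_preimage.1 ha
    rw [hS.dep]
  · obtain ⟨j, -, rfl⟩ := mem_preimage.1 ha
    obtain ⟨j', -, rfl⟩ := mem_preimage.1 hb
    rw [hS.sem, hS.sem]
    rintro ⟨h1, h2⟩
    exact hab (by rw [← h1, ← h2])
  · constructor
    · intro h
      exact ⟨S + st ν, mem_preimage.2 ⟨_, h, rfl⟩, (hS.sem _ ν).2 rfl⟩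
    · rintro ⟨a, ha, h⟩
      obtain ⟨j, hj, rfl⟩ := mem_preimage.1 ha
      rw [hS.sem] at h
      simpa [h] using hj

/-- The states in which the first `b` queries of the chain hold exactly as prescribed. -/
noncomputable def acceptStates (k b : ℕ) (pat : ℕ → Prop) (i : Fin (numStates k)) : Bool :=
  open Classical in decide (MatchesPattern b pat ((stateNum k).symm i))

/-- Write a circuit for one half of the conditions on the queries `h_{k,i}` and store the position
of its output gate in `X_r`. -/
noncomputable def halfProg (k c : ℕ) (use : ℕ → Bool) (b : ℕ) (pat : ℕ → Prop) (r : ℕ) : Prog :=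
  .seq (pass k c use)
    (writeGate (orWords (preimageWords (acceptStates k b pat) 0 true)) (numStates k) r)

/-- The gate number `j` of `A` captures `s` and depends on `d` only. -/
structure GateAt {X : Type} (A : List (AnnotatedGate X)) (j : ℕ) (s : Set X → Prop) (d : Set X) :
    Prop where
  lt : j < A.length
  sem : ∀ ν, semAt A j ν ↔ s ν
  dep : depAt A j = d

theorem GateAt.mono {X : Type} {A B : List (AnnotatedGate X)} {j : ℕ} {s : Set X → Prop}
    {d : Set X} (h : GateAt A j s d) (hAB : A <+: B) : GateAt B j s d := by
  obtain ⟨C, rfl⟩ := hAB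
  refine ⟨?_, fun ν => ?_, ?_⟩
  · have := h.lt; simp; omega
  · rw [semAt_append_left h.lt, h.sem]
  · rw [depAt_append_left h.lt, h.dep]

theorem gateAt_length {X : Type} (A : List (AnnotatedGate X)) (e : AnnotatedGate X) :
    GateAt (A ++ [e]) A.length e.sem e.dep := by
  have h : (A ++ [e])[A.length]? = some e := by simp
  exact ⟨by simp, fun ν => semAt_iff h ν, depAt_eq h⟩

theorem Reaches.halfProg {c b r : ℕ} {use : ℕ → Bool} {pat : ℕ → Prop} (hc : c ≤ k + 1)
    (hL : L.Nodup) {A : List (AnnotatedGate (DBFact k))} (hσ : Written L A σ) (hr : 3 < r)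
    (h : ∀ (τ : State) (B : List (AnnotatedGate (DBFact k))), Written L B τ → A <+: B →
      A.length ≤ τ.reg r → GateAt B (τ.reg r) (fun ν => MatchesPattern b pat (passFeatures c use L ν))
        {f | f ∈ L ∧ use f.rel = true} →
      (∀ s, s ≠ 3 → s ≠ r → (s < 6 ∨ 23 < s) → τ.reg s = σ.reg s) → Q τ) :
    Reaches L.length (halfProg k c use b pat r) Q σ := by
  refine .seq (.pass hc hL hσ.env hσ.certified hσ.out hσ.size fun τ ho ⟨B, hAB, hB, hout, hS⟩ => ?_)
  refine .writeGate _ ?_ ?_ (ho.env hσ.env) hB (gateOK_select hS (acceptStates k b pat)) hout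
    hS.length.symm hr fun τ' hw h1 h2 => h τ' _ hw (hAB.trans (List.prefix_append _ _)) ?_ ?_ ?_
  · intro w hw
    simp only [orWords, List.mem_cons] at hw
    rcases hw with rfl | rfl | hw
    · simp
    · simp
    · exact mem_preimageWords_ne hw
  · rw [map_wordVal_orWords (k := k) (ho.env hσ.env).zero, map_wordVal_preimageWords, Nat.add_zero]
  · rw [h1]; exact hAB.length_le
  · rw [h1]
    have := gateAt_length B ⟨.or (preimage (acceptStates k b pat) (τ.reg 3) true),
      fun ν => acceptStates k b pat (passState c L 0 0 {f | f ∈ L ∧ use f.rel = true} ν) = true,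
      {f | f ∈ L ∧ use f.rel = true}⟩
    refine ⟨this.lt, fun ν => ?_, this.dep⟩
    rw [this.sem]
    classical
    refine decide_eq_true_iff.trans ?_
    rw [passState, Equiv.symm_apply_apply]
    rfl
  · intro s h3 h4 h5
    rw [h2 s h3 (by omega) h4, ho.2 s h3 h5]

/-- Write a circuit testing whether the set of the queries that hold is `N` or `insert l N`, and
store the position of its output gate in `X_24`. -/
noncomputable def pairProg (N : Finset (Fin (k + 1))) (l : Fin (k + 1)) : Prog :=
  .seq (halfProg k 0 (fun r => decide (r ≤ (l : ℕ))) l (fun j => ∃ i ∈ N, (i : ℕ) = j) 5) <|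
  .seq (halfProg k (k + 1) (fun r => decide ((l : ℕ) < r)) (k - l)
    (fun j => ∃ i ∈ N, (i : ℕ) + j = k) 24) <|
  writeGate (andWords [(5, 0), (24, 0)]) 0 24

theorem Reaches.pairProg (hk : 1 ≤ k) {N : Finset (Fin (k + 1))} {l : Fin (k + 1)} (hl : l ∉ N)
    (hL : L.Nodup) {A : List (AnnotatedGate (DBFact k))} (hσ : Written L A σ)
    (h : ∀ (τ : State) (B : List (AnnotatedGate (DBFact k))), Written L B τ → A <+: B →
      A.length ≤ τ.reg 24 → GateAt B (τ.reg 24) (fun ν => heldQueries ({f | f ∈ L} ∩ ν) ∈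
        ({N, insert l N} : Finset (Finset (Fin (k + 1))))) Set.univ →
      τ.reg 4 = σ.reg 4 → Q τ) :
    Reaches L.length (pairProg N l) Q σ := by
  refine .seq (.halfProg (by omega) hL hσ (by omega) fun τ₁ A₁ a1 a2 a3 a4 a5 =>
    .seq (.halfProg le_rfl hL a1 (by omega) fun τ₂ A₂ b1 b2 b3 b4 b5 => ?_))
  -- A pass changes only `X_3` and the registers from 6 to 23, so the first result survives in
  -- `X_5`.
  have e5 : τ₂.reg 5 = τ₁.reg 5 := b5 5 (by omega) (by omega) (by omega)
  have lt5 := a4.lt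
  have c4 := a4.mono b2
  rw [← e5] at c4 lt5
  have hne : τ₂.reg 5 ≠ τ₂.reg 24 := by omega
  refine .writeGate ⟨.and [τ₂.reg 5, τ₂.reg 24], fun ν => heldQueries ({f | f ∈ L} ∩ ν) ∈
        ({N, insert l N} : Finset (Finset (Fin (k + 1)))), Set.univ⟩ (by simp [andWords]) ?_ b1.env
    b1.certified ?_ b1.out b1.size (by omega) fun τ hw h1 h2 =>
    h τ _ hw ((a2.trans b2).trans (List.prefix_append _ _)) ?_ ?_ ?_
  · rw [map_wordVal_andWords (k := k) b1.env.zero]; simp [wordVal]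
  · refine ⟨?_, ?_, ?_, ?_, fun ν => ?_⟩
    · simp [Gate.inputs, c4.lt, b4.lt]
    · simp [Gate.inputs, hne]
    · simp
    -- The halves depend on facts with relation number at most `l` and greater than `l`,
    -- respectively.
    · have hd : ∀ x, ¬ (x ∈ depAt A₂ (τ₂.reg 5) ∧ x ∈ depAt A₂ (τ₂.reg 24)) := by
        rw [c4.dep, b4.dep]
        rintro x ⟨⟨-, h1⟩, -, h2⟩
        simp only [decide_eq_true_eq] at h1 h2
        omega
      intro j₁ h₁ j₂ h₂ hj x hx
      simp only [List.mem_cons, List.not_mem_nil, or_false] at h₁ h₂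
      rcases h₁ with rfl | rfl <;> rcases h₂ with rfl | rfl
      · exact hj rfl
      · exact hd x hx
      · exact hd x hx.symm
      · exact hj rfl
    · refine (matchesPattern_iff hk l N hl ν).symm.trans ?_
      simp [c4.sem, b4.sem]
  · rw [h1]; exact (a2.trans b2).length_le
  · rw [h1]; exact gateAt_length _ _
  · rw [h2 4 (by omega) (by omega) (by omega), b5 4 (by omega) (by omega) (by omega),
      a5 4 (by omega) (by omega) (by omega)]

/-- The dependency annotation may be trivial here: above the gates that test pairs there are only ∨-
and ¬-gates, so decomposability is no longer at stake. -/
theorem gateOK_or_pair {X : Type} {D : Set X} {A : List (AnnotatedGate X)} {i j : ℕ}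
    {s s' t : Set X → Prop} {d d' : Set X} (hi : GateAt A i s d) (hj : GateAt A j s' d')
    (hne : i ≠ j) (hd : ∀ ν, ¬ (s ν ∧ s' ν)) (ht : ∀ ν, t ν ↔ s ν ∨ s' ν) :
    GateOK D A ⟨.or [i, j], t, Set.univ⟩ := by
  refine ⟨by simp [Gate.inputs, hi.lt, hj.lt], by simp [Gate.inputs, hne], by simp, ?_,
    fun ν => by simp [ht, hi.sem, hj.sem]⟩
  intro j₁ h₁ j₂ h₂ h ν
  simp only [List.mem_cons, List.not_mem_nil, or_false] at h₁ h₂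
  have := hd ν
  rcases h₁ with rfl | rfl <;> rcases h₂ with rfl | rfl
  · exact absurd rfl h
  · rwa [hi.sem, hj.sem]
  · rwa [hi.sem, hj.sem, and_comm]
  · exact absurd rfl h

/-- The last gate of the circuit written so far is at position `X_4` and tells whether the set of
the queries that hold belongs to the family `F`. -/
def Captures (L : List (DBFact k)) (F : Finset (Finset (Fin (k + 1)))) (τ : State) : Prop :=
  ∃ B, Written L B τ ∧ τ.reg 4 + 1 = B.length ∧
    GateAt B (τ.reg 4) (fun ν => heldQueries ({f | f ∈ L} ∩ ν) ∈ F) Set.univ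

/-- Induction on the derivation of `F`, which becomes the text of the program; the program is chosen
before the database. -/
theorem exists_prog_captures (hk : 1 ≤ k) {F : Finset (Finset (Fin (k + 1)))}
    (hF : PairReachable F) : ∃ P : Prog, ∀ L : List (DBFact k), L.Nodup → ∀ σ : State,
      Written L [] σ → Reaches L.length P (Captures L F) σ := by
  induction hF with
  | empty =>
    refine ⟨writeGate (orWords []) 0 4, fun L hL σ hσ => ?_⟩
    refine .writeGate ⟨.or [], fun ν => heldQueries ({f | f ∈ L} ∩ ν) ∈
      (∅ : Finset (Finset (Fin (k + 1)))), Set.univ⟩ (by simp [orWords])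
      (map_wordVal_orWords hσ.env.zero []) hσ.env hσ.certified ?_ hσ.out hσ.size (by omega) fun τ hw h1 h2 => ⟨_, hw, by simp [h1], h1 ▸ gateAt_length _ _⟩
    refine ⟨?_, ?_, ?_, ?_⟩ <;> simp [Gate.inputs, GateSound]
  | @union F hF N l hl hN hN' ih =>
    obtain ⟨P, hP⟩ := ih
    refine ⟨.seq P (.seq (pairProg N l) (writeGate (orWords [(4, 0), (24, 0)]) 0 4)),
      fun L hL σ hσ => .seq ((hP L hL σ hσ).mono fun τ₁ ⟨B, hB, hlen, hat⟩ => ?_)⟩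
    refine .seq (.pairProg hk hl hL hB fun τ₂ C a1 a2 a3 a4 a5 => ?_)
    have lt4 := hat.lt
    have c4 := hat.mono a2
    rw [← a5] at c4 lt4
    have hne : τ₂.reg 4 ≠ τ₂.reg 24 := by omega
    refine .writeGate ⟨.or [τ₂.reg 4, τ₂.reg 24], fun ν => heldQueries ({f | f ∈ L} ∩ ν) ∈
      F ∪ {N, insert l N}, Set.univ⟩ (by simp [orWords]) ?_ a1.env a1.certified ?_ a1.out a1.size
      (by omega) fun τ hw h1 h2 => ⟨_, hw, by simp [h1], h1 ▸ gateAt_length _ _⟩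
    · rw [map_wordVal_orWords (k := k) a1.env.zero]; simp [wordVal]
    · refine gateOK_or_pair c4 a4 hne (fun ν => ?_) fun ν => Finset.mem_union
      rw [Finset.mem_insert, Finset.mem_singleton]
      rintro ⟨h1, h2 | h2⟩
      · exact hN (h2 ▸ h1)
      · exact hN' (h2 ▸ h1)
  | @sdiff F hF N l hl hN hN' ih =>
    obtain ⟨P, hP⟩ := ih
    refine ⟨.seq P (.seq (pairProg N l) (.seq (writeGate (negWords (4, 0)) 0 4)
      (.seq (writeGate (orWords [(4, 0), (24, 0)]) 0 4) (writeGate (negWords (4, 0)) 0 4)))),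
      fun L hL σ hσ => .seq ((hP L hL σ hσ).mono fun τ₁ ⟨B, hB, hlen, hat⟩ => ?_)⟩
    refine .seq (.pairProg hk hl hL hB fun τ₂ C a1 a2 a3 a4 a5 => ?_)
    have c4 := hat.mono a2
    rw [← a5] at c4
    refine .seq (.writeGate ⟨.neg (τ₂.reg 4), fun ν => heldQueries ({f | f ∈ L} ∩ ν) ∉ F,
      Set.univ⟩ (by simp [negWords]) ?_ a1.env a1.certified ?_ a1.out a1.size
      (by omega) fun τ₃ b1 b2 b3 => ?_)
    · rw [map_wordVal_negWords (k := k) a1.env.zero]; simp [wordVal]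
    · exact ⟨by simp [Gate.inputs, c4.lt], by simp [Gate.inputs], by simp,
        fun ν => by simp [c4.sem]⟩
    have d4 := gateAt_length C (⟨.neg (τ₂.reg 4), fun ν => heldQueries ({f | f ∈ L} ∩ ν) ∉ F,
      Set.univ⟩ : AnnotatedGate (DBFact k))
    have d24 := a4.mono (List.prefix_append C [⟨.neg (τ₂.reg 4),
      fun ν => heldQueries ({f | f ∈ L} ∩ ν) ∉ F, Set.univ⟩])
    have hne : C.length ≠ τ₂.reg 24 := by have := a4.lt; omega
    rw [← b3 24 (by omega) (by omega) (by omega)] at d24 hne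
    rw [← b2] at d4 hne
    -- The complement of the difference is the complement of `F` together with the pair, and these
    -- are disjoint because the pair lies in `F`. One more negation then yields the difference.
    refine .seq (.writeGate ⟨.or [τ₃.reg 4, τ₃.reg 24], fun ν => heldQueries ({f | f ∈ L} ∩ ν) ∉
      F \ {N, insert l N}, Set.univ⟩ (by simp [orWords]) ?_ b1.env b1.certified ?_ b1.out b1.size
      (by omega) fun τ₄ e1 e2 e3 => ?_)
    · rw [map_wordVal_orWords (k := k) b1.env.zero]; simp [wordVal]
    · refine gateOK_or_pair d4 d24 hne (fun ν => ?_) fun ν => ?_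
      · rw [Finset.mem_insert, Finset.mem_singleton]
        rintro ⟨h1, h2 | h2⟩
        · exact h1 (h2 ▸ hN)
        · exact h1 (h2 ▸ hN')
      · simp only [Finset.mem_sdiff]
        tauto
    have f4 := gateAt_length (C ++ [⟨.neg (τ₂.reg 4), fun ν => heldQueries ({f | f ∈ L} ∩ ν) ∉ F,
      Set.univ⟩]) (⟨.or [τ₃.reg 4, τ₃.reg 24], fun ν => heldQueries ({f | f ∈ L} ∩ ν) ∉
      F \ {N, insert l N}, Set.univ⟩ : AnnotatedGate (DBFact k))
    rw [← e2] at f4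
    refine .writeGate ⟨.neg (τ₄.reg 4), fun ν => heldQueries ({f | f ∈ L} ∩ ν) ∈
      F \ {N, insert l N}, Set.univ⟩ (by simp [negWords]) ?_ e1.env e1.certified ?_ e1.out e1.size
      (by omega) fun τ hw h1 h2 => ⟨_, hw, by simp [h1], h1 ▸ gateAt_length _ _⟩
    · rw [map_wordVal_negWords (k := k) e1.env.zero]; simp [wordVal]
    · refine ⟨?_, by simp [Gate.inputs], by simp, fun ν => ?_⟩
      · have h1 := f4.lt
        simp only [Gate.inputs, List.mem_singleton]
        rintro j rfl; exact h1
      · simp only [f4.sem, not_not]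

theorem inDDPTIME_queryOf (hk : 1 ≤ k) (φ : BoolFun k) (hφ : eulerChar φ = 0) :
    InDDPTIME (queryOf φ) := by
  obtain ⟨P, hP⟩ := exists_prog_captures hk (pairReachable_of_sum_eq_zero _ hφ)
  -- The prologue copies the number of facts from `M[0]` to `X_1` and sets `X_2` to 1, as `Env`
  -- demands; the polynomial is the cost of the whole program.
  refine ⟨.seq (.load 1 0) (.seq (.const 2 1) P),
    (Prog.seq (.load 1 0) (.seq (.const 2 1) P)).cost, fun D L hL hD => ?_⟩
  have hcard : D.card = L.length := by
    classical
    have : D = L.toFinset := by ext x; simp [hD]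
    rw [this, List.toFinset_card_of_nodup hL]
  have hrun : Reaches L.length (.seq (.load 1 0) (.seq (.const 2 1) P))
      (Captures L (Finset.univ.filter fun ν => φ ν = true)) (inputState L) := by
    refine .seq (.load (.seq (.const (hP L hL _ ⟨⟨?_, ?_, ?_, rfl⟩, .nil, rfl, ?_⟩))))
    all_goals simp [inputState]
  obtain ⟨t, τ, hexec, ht, B, hB, hlen, hat⟩ := hrun
  have hne : B ≠ [] := by rintro rfl; simp at hlen
  refine ⟨t, τ, hB.certified.circuit hne, hexec, hcard ▸ ht, ?_, hB.certified.isDD hne,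
    fun x hx => (hD x).1 (hB.certified.mem_of_var hx), fun D' hD' => ?_⟩
  · rw [hB.out, Circuit.code, gatesCode]
    simp [Certified.circuit, List.flatMap_map]
  · have hpos : (hB.certified.circuit hne).gates.length - 1 = τ.reg 4 := by
      simp only [Certified.circuit, List.length_map]; omega
    -- The gates speak about the listed facts of a valuation, which for a sub-database are all of
    -- its facts.
    have hD'' : {f | f ∈ L} ∩ D' = D' := Set.inter_eq_right.2 fun x hx => (hD x).2 (hD' hx)
    rw [Circuit.eval, hpos, hB.certified.val_iff, hat.sem, hD'']
    simp [queryOf, heldQueries]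

end Program

end HQueries

theorem mainTheorem1 (k : ℕ) (hk : 1 ≤ k) (φ : HQueries.BoolFun k)
    (hφ : HQueries.eulerChar φ = 0) : HQueries.InDDPTIME (HQueries.queryOf φ) :=
  HQueries.inDDPTIME_queryOf hk φ hφ
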